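/- For a set $X\subseteq\omega$ write $\deg_T(X)$ for its Turing degree, and write $\mathcal D(\ge \mathbf d)$ for the set of Turing degrees $\ge\mathbf d$. A set of degrees is finitely generated if it is a finite union of cones $\mathcal D(\ge\mathbf d)$. For computable structures $\mathcal A,\mathcal B$ let $\mathrm{IsoSpec}(\mathcal A,\mathcal B)$ be the set of Turing degrees that compute some isomorphism $\mathcal A\cong\mathcal B$. If $(x_i)_{i<\omega}$ is a computable enumeration without repetitions of a set $X\subseteq\omega$, let $(\omega,<_X)$ be the linear order determined by $2n<_X2m$ for $n<m$ and $2x_n<_X2n+1<_X2x_n+2$ for all $n$. Let $\mathcal H$ be the structure with universe $H=[\omega]^{<\omega}\sqcup(\omega\times\{0,1\})$ (where $[\omega]^{<\omega}$ is the set of finite subsets of $\omega$) and binary relations $D_i,E_i$ $(i<\omega)$, where $E_i(X,Y)$ holds iff $X,Y\in[\omega]^{<\omega}$ and $X\triangle Y=\{i\}$, and $D_i(X,(i,a))$ holds iff $X\in[\omega]^{<\omega}$ and $a$ is the value at $i$ of the characteristic function of $X$ (and $D_i$ holds of no other pairs). Given sequences $(\mathcal A_n)_{n<\omega}$ and $(\mathcal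 B_n)_{n<\omega}$ of structures with universe $\omega$ in a common relational language $\mathcal L$, let $\mathcal M$ have universe $H\sqcup(H\times\omega)$ and relations as follows. The binary relation $\mu$ holds exactly of the pairs $(z,z)$ and $((z,k),z)$ with $z\in H$, $k\in\omega$. The relations $D_i,E_i$ are those of $\mathcal H$ on $H$ and hold nowhere else. Each symbol of $\mathcal L$ is interpreted on $\{z\}\times\omega$ as in the component $\mathcal M_z$, for each $z\in H$, and holds of no other tuples. Here $\mathcal M_{(i,0)}=\mathcal A_{i+1}$, $\mathcal M_{(i,1)}=\mathcal B_{i+1}$, and for $X\in[\omega]^{<\omega}$, $\mathcal M_X=\mathcal A_0$ if $|X|$ is even and $\mathcal M_X=\mathcal B_0$ if $|X|$ is odd. Let $\mathcal N$ be defined in the same way with components $\mathcal N_{(i,0)}=\mathcal A_{i+1}$, $\mathcal N_{(i,1)}=\mathcal B_{i+1}$, and $\mathcal N_X=\mathcal B_0$ if $|X|$ is even, $\mathcal N_X=\mathcal A_0$ if $|X|$ is odd. **Theorem.** There is a uniformly c.e. sequence $(X_n)_{n<\omega}$ of subsets of $\omega$ whose Turing degrees are pairwise incomparable. Moreover, let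 $(X_n)_{n<\omega}$ be any such sequence, with $\mathbf d_n=\deg_T(X_n)$. Then the sets $X_n$ have uniformly computable enumerations without repetitions. For every choice of such enumerations, put $\mathcal A_n=(\omega,<)$ and $\mathcal B_n=(\omega,<_{X_n})$ for all $n$, and let $\mathcal M,\mathcal N$ be the structures defined above from these sequences. Then $(\mathcal A_n)_n$ and $(\mathcal B_n)_n$ are uniformly computable sequences of structures with $\mathcal A_n\cong\mathcal B_n$ for all $n$; $\mathcal M$ and $\mathcal N$ are computable structures and $\mathcal M\cong\mathcal N$; and $$\mathrm{IsoSpec}(\mathcal M,\mathcal N)=\bigcup_{n<\omega}\mathrm{IsoSpec}(\mathcal A_n,\mathcal B_n)=\bigcup_{n<\omega}\mathcal D(\ge\mathbf d_n),$$ and this set is not finitely generated. -/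

import Mathlib

namespace IsoSpectra

/-! ### Turing degrees of sets of natural numbers -/

open scoped Classical in
/-- The characteristic function of `X`, as an oracle. -/
noncomputable def chi (X : Set ℕ) : ℕ →. ℕ := fun n => Part.some (if n ∈ X then 1 else 0)

/-- Turing reducibility `X ≤_T Y` between sets of natural numbers. -/
def SetReducible (X Y : Set ℕ) : Prop := TuringReducible (chi X) (chi Y)

instance setReducible_isPreorder : IsPreorder (Set ℕ) SetReducible where
  refl X := TuringReducible.refl (chi X)
  trans _ _ _ h₁ h₂ := TuringReducible.trans h₁ h₂

/-- The partially ordered set of Turing degrees (of sets of natural numbers). -/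
abbrev Degree : Type := Antisymmetrization (Set ℕ) SetReducible

/-- The order on degrees: `deg X ≤ deg Y` iff `X ≤_T Y`. -/
noncomputable instance degreePartialOrder : PartialOrder Degree :=
  @instPartialOrderAntisymmetrization (Set ℕ)
    { le := SetReducible
      lt := fun X Y => SetReducible X Y ∧ ¬ SetReducible Y X
      le_refl := fun X => TuringReducible.refl (chi X)
      le_trans := fun _ _ _ h₁ h₂ => TuringReducible.trans h₁ h₂ }

/-- The Turing degree of a set. -/
def deg (X : Set ℕ) : Degree := toAntisymmetrization SetReducible X

theorem deg_le_deg_iff (X Y : Set ℕ) : deg X ≤ deg Y ↔ TuringReducible (chi X) (chi Y) :=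
  Iff.rfl

/-- A set of degrees is finitely generated if it is the upward closure of a finite set of degrees,
that is, a finite union of cones `D(≥ d)`. -/
def FinitelyGenerated (U : Set Degree) : Prop :=
  ∃ F : Set Degree, F.Finite ∧ U = ⋃ d ∈ F, Set.Ici d

/-! ### Computable relational structures and isomorphism spectra

The language comes with a coding of its relation symbols (tagged with their arities), the universe
with a coding of its elements by a computable set of natural numbers. -/

/-- The (relational part of the) atomic diagram of `A`: the pairs of a relation symbol and a list
of elements, of length the arity of the symbol, that satisfies it in `A`. -/
def AtomicDiagram {L : FirstOrder.Language.{0, 0}} {M : Type} (A : L.Structure M) :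
    (Σ n, L.Relations n) × List M → Prop :=
  fun p => ∃ v : Fin p.1.1 → M, List.ofFn v = p.2 ∧ A.RelMap p.1.2 v

/-- The language is computable: the arity of a symbol can be computed from its code. -/
def ComputableLanguage (L : FirstOrder.Language.{0, 0}) [Primcodable (Σ n, L.Relations n)] : Prop :=
  Computable (fun R : (Σ n, L.Relations n) => R.1)

/-- `A` is a computable structure. -/
def ComputableStructure {L : FirstOrder.Language.{0, 0}} [L.IsRelational] [Primcodable (Σ n, L.Relations n)]
    {M : Type} [Primcodable M] (A : L.Structure M) : Prop :=
  ComputableLanguage L ∧ ComputablePred (AtomicDiagram A)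

/-- The collection `{A i : i ∈ I}` of structures is uniformly computable: their atomic diagrams
are computable uniformly in the index. -/
def UniformlyComputable {L : FirstOrder.Language.{0, 0}} [L.IsRelational] [Primcodable (Σ n, L.Relations n)]
    {I M : Type} [Primcodable I] [Primcodable M] (A : I → L.Structure M) : Prop :=
  ComputableLanguage L ∧
    ComputablePred fun q : I × ((Σ n, L.Relations n) × List M) => AtomicDiagram (A q.1) q.2

/-- The type of isomorphisms from the structure `A` to the structure `B`. -/
abbrev Iso {L : FirstOrder.Language.{0, 0}} {M N : Type} (A : L.Structure M) (B : L.Structure N) : Type :=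
  @FirstOrder.Language.Equiv L M N A B

/-- The function `f` is computable from the degree `d`. -/
def ComputableFrom {M N : Type} [Primcodable M] [Primcodable N] (f : M → N) (d : Degree) : Prop :=
  ∃ X : Set ℕ, deg X = d ∧ ComputableIn {chi X} f

/-- The isomorphism spectrum: the set of degrees computing some isomorphism from `A` to `B`. -/
def IsoSpec {L : FirstOrder.Language.{0, 0}} {M N : Type} [Primcodable M] [Primcodable N]
    (A : L.Structure M) (B : L.Structure N) : Set Degree :=
  {d | ∃ f : Iso A B, ComputableFrom f.toEquiv d}

/-! ### Uniformly c.e. sequences and the orders `<_X` -/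

/-- The sequence of sets `X` is uniformly computably enumerable. -/
def UniformlyCE (X : ℕ → Set ℕ) : Prop :=
  REPred fun p : ℕ × ℕ => p.2 ∈ X p.1

/-- `x` provides, uniformly in `n`, a computable enumeration `x n 0, x n 1, …` without repetitions
of the set `X n`. -/
def UniformEnumeration (x : ℕ → ℕ → ℕ) (X : ℕ → Set ℕ) : Prop :=
  Computable₂ x ∧ ∀ n, Function.Injective (x n) ∧ Set.range (x n) = X n

/-- Auxiliary position: `2n` is put at position `2n`, and `2n+1` at position `2 * x n + 1`. -/
def position (x : ℕ → ℕ) (a : ℕ) : ℕ := if a % 2 = 0 then a else 2 * x (a / 2) + 1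

/-- The order `<_X` given by an enumeration `x` (without repetitions) of `X`. -/
def ltEnum (x : ℕ → ℕ) (a b : ℕ) : Prop := position x a < position x b

/-- `ltEnum x` is the unique strict linear order `<_X` on `ω` with `2n <_X 2m` for `n < m` and
`2 x_n <_X 2n+1 <_X 2 x_n + 2` for all `n`. -/
theorem ltEnum_characterization (x : ℕ → ℕ) (hx : Function.Injective x) (r : ℕ → ℕ → Prop) :
    (IsStrictTotalOrder ℕ r ∧ (∀ n m, n < m → r (2 * n) (2 * m)) ∧
      ∀ n, r (2 * x n) (2 * n + 1) ∧ r (2 * n + 1) (2 * x n + 2)) ↔ r = ltEnum x := by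
  have he : ∀ n, position x (2 * n) = 2 * n := fun n => by simp [position]
  have ho : ∀ n, position x (2 * n + 1) = 2 * x n + 1 := fun n => by
    have h1 : (2 * n + 1) % 2 = 1 := by omega
    have h2 : (2 * n + 1) / 2 = n := by omega
    simp [position, h1, h2]
  have hinj : Function.Injective (position x) := by
    intro a b hab
    obtain ⟨k, hk⟩ := Nat.even_or_odd' a
    obtain ⟨l, hl⟩ := Nat.even_or_odd' b
    rcases hk with rfl | rfl <;> rcases hl with rfl | rfl <;>
      simp only [he, ho] at hab
    · exact hab
    · omega
    · omega
    · have := hx (show x k = x l by omega)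
      rw [this]
  constructor
  · rintro ⟨hr, h1, h2⟩
    have key : ∀ a b, position x a < position x b → r a b := by
      intro a b hab
      have mono : ∀ n m, n ≤ m → ∀ c, r c (2 * n) → r c (2 * m) := by
        intro n m hnm c hc
        rcases hnm.eq_or_lt with rfl | h
        · exact hc
        · exact hr.trans _ _ _ hc (h1 _ _ h)
      obtain ⟨k, hk⟩ := Nat.even_or_odd' a
      obtain ⟨l, hl⟩ := Nat.even_or_odd' b
      rcases hk with rfl | rfl <;> rcases hl with rfl | rfl <;>
        simp only [he, ho] at hab
      · exact h1 _ _ (by omega)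
      · rcases (show k ≤ x l by omega).eq_or_lt with h | h
        · rw [h]; exact (h2 l).1
        · exact hr.trans _ _ _ (h1 _ _ h) (h2 l).1
      · exact mono (x k + 1) l (by omega) _ (h2 k).2
      · exact hr.trans _ _ _ (mono (x k + 1) (x l) (by omega) _ (h2 k).2) (h2 l).1
    funext a b
    apply propext
    constructor
    · intro hab
      by_contra hn
      rcases (not_lt.mp hn).eq_or_lt with h | h
      · rw [hinj h] at hab; exact hr.irrefl _ hab
      · exact hr.irrefl _ (hr.trans _ _ _ hab (key _ _ h))
    · exact key a b
  · rintro rfl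
    refine ⟨?_, ?_, ?_⟩
    · exact
        { trichotomous := fun a b h1 h2 => hinj (le_antisymm (not_lt.mp h2) (not_lt.mp h1))
          irrefl := fun a => lt_irrefl (position x a)
          trans := fun a b c (h1 : position x a < position x b) h2 => lt_trans h1 h2 }
    · intro n m h
      simp only [ltEnum, he]; omega
    · intro n
      have := he (x n + 1)
      rw [show 2 * (x n + 1) = 2 * x n + 2 by ring] at this
      simp only [ltEnum, he, ho, this]; omega

/-- The only relation symbol of the language `{<}`, of arity two. -/
inductive LtSym : ℕ → Type
  | lt : LtSym 2

/-- The language `{<}`. -/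
def ltLang : FirstOrder.Language.{0, 0} := ⟨fun _ => Empty, LtSym⟩

instance ltLang_isRelational : ltLang.IsRelational := fun _ => ⟨fun f => Empty.elim f⟩

/-- The structure `(ω, r)`. -/
@[reducible] def orderStructure (r : ℕ → ℕ → Prop) : ltLang.Structure ℕ where
  funMap := fun f => Empty.elim f
  RelMap := fun {_} R => match R with
    | LtSym.lt => fun v => r (v 0) (v 1)

/-- The collection `A` with `A n = (ω, <)` for all `n`. -/
@[reducible] def copiesA : ℕ → ltLang.Structure ℕ := fun _ => orderStructure (· < ·)

/-- The collection `B` with `B n = (ω, <_{X_n})`, where `x n` is the enumeration of `X_n`. -/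
@[reducible] def copiesB (x : ℕ → ℕ → ℕ) : ℕ → ltLang.Structure ℕ := fun n => orderStructure (ltEnum (x n))

/-! ### Computable composition -/

/-- The relation symbol `μ`, of arity two. -/
inductive MuSym : ℕ → Type
  | mu : MuSym 2

/-- The language `{μ}`. -/
def muLang : FirstOrder.Language.{0, 0} := ⟨fun _ => Empty, MuSym⟩

instance muLang_isRelational : muLang.IsRelational := fun _ => ⟨fun f => Empty.elim f⟩

/-- The language `{μ} ∪ L_S ∪ L` of a composition. -/
abbrev compLang (LS L : FirstOrder.Language.{0, 0}) : FirstOrder.Language.{0, 0} := muLang.sum (LS.sum L)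

/-- The composition `S[{x} × A x : x ∈ S]` of a base structure `𝒮` with universe `S` with structures
`A x` on `ω`. Its universe is the disjoint union of `S` and the sets `{x} × ω`. Here `μ` relates
every element of `{x} × ω`, and `x` itself, to `x`; a symbol of `LS` holds exactly of the tuples
from `S` of which it holds in `𝒮`; a symbol of `L` holds exactly of the tuples from one component
`{x} × ω` of which it holds in `A x`. -/
@[reducible] def composition {LS L : FirstOrder.Language.{0, 0}} [LS.IsRelational] [L.IsRelational] {S : Type}
    (𝒮 : LS.Structure S) (A : S → L.Structure ℕ) : (compLang LS L).Structure (S ⊕ S × ℕ) where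
  funMap := fun f => isEmptyElim f
  RelMap := fun {n} R => match n, R with
    | _, Sum.inl MuSym.mu => fun v =>
        ∃ x : S, v 1 = Sum.inl x ∧ (v 0 = Sum.inl x ∨ ∃ a : ℕ, v 0 = Sum.inr (x, a))
    | n, Sum.inr (Sum.inl R) => fun v =>
        ∃ s : Fin n → S, (v = fun i => Sum.inl (s i)) ∧ 𝒮.RelMap R s
    | n, Sum.inr (Sum.inr Q) => fun v =>
        ∃ (x : S) (a : Fin n → ℕ), (v = fun i => Sum.inr (x, a i)) ∧ (A x).RelMap Q a

/-! ### The hypercube structure `H` and the structures `M` and `N` -/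

/-- The universe of `H`: finite subsets of `ω`, and pairs in `ω × {0, 1}`. -/
abbrev Hyp : Type := Finset ℕ ⊕ ℕ × Bool

/-- The relation symbols `D_i` and `E_i`, all of arity two. -/
inductive HypSym : ℕ → Type
  | D (i : ℕ) : HypSym 2
  | E (i : ℕ) : HypSym 2

/-- The language `{D_i, E_i : i < ω}`. -/
def hypLang : FirstOrder.Language.{0, 0} := ⟨fun _ => Empty, HypSym⟩

instance hypLang_isRelational : hypLang.IsRelational := fun _ => ⟨fun f => Empty.elim f⟩

/-- The structure `H`: `D_i (X, (i, a))` iff `X(i) = a`, and `E_i (X, Y)` iff `X ∆ Y = {i}`. -/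
@[reducible] def hypStructure : hypLang.Structure Hyp where
  funMap := fun f => Empty.elim f
  RelMap := fun {_} R => match R with
    | HypSym.D i => fun v =>
        ∃ X : Finset ℕ, v 0 = Sum.inl X ∧ v 1 = Sum.inr (i, decide (i ∈ X))
    | HypSym.E i => fun v =>
        ∃ X Y : Finset ℕ, v 0 = Sum.inl X ∧ v 1 = Sum.inl Y ∧ symmDiff X Y = {i}

/-- The components of `M`. -/
@[reducible] def componentM {L : FirstOrder.Language.{0, 0}} (A B : ℕ → L.Structure ℕ) : Hyp → L.Structure ℕ
  | Sum.inr (i, false) => A (i + 1)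
  | Sum.inr (i, true) => B (i + 1)
  | Sum.inl X => if Even X.card then A 0 else B 0

/-- The components of `N`. -/
@[reducible] def componentN {L : FirstOrder.Language.{0, 0}} (A B : ℕ → L.Structure ℕ) : Hyp → L.Structure ℕ
  | Sum.inr (i, false) => A (i + 1)
  | Sum.inr (i, true) => B (i + 1)
  | Sum.inl X => if Even X.card then B 0 else A 0

/-- The structure `M` obtained from the collections `A` and `B`. -/
@[reducible] def structureM {L : FirstOrder.Language.{0, 0}} [L.IsRelational] (A B : ℕ → L.Structure ℕ) :
    (compLang hypLang L).Structure (Hyp ⊕ Hyp × ℕ) :=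
  composition hypStructure (componentM A B)

/-- The structure `N` obtained from the collections `A` and `B`. -/
@[reducible] def structureN {L : FirstOrder.Language.{0, 0}} [L.IsRelational] (A B : ℕ → L.Structure ℕ) :
    (compLang hypLang L).Structure (Hyp ⊕ Hyp × ℕ) :=
  composition hypStructure (componentN A B)

/-! ### Codings of the relation symbols -/

/-- There is exactly one symbol in `{<}`. -/
def ltSymEquiv : (Σ n, ltLang.Relations n) ≃ Unit where
  toFun _ := ()
  invFun _ := ⟨2, LtSym.lt⟩
  left_inv := by rintro ⟨_, ⟨⟩⟩; rfl
  right_inv _ := rfl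

/-- There is exactly one symbol in `{μ}`. -/
def muSymEquiv : (Σ n, muLang.Relations n) ≃ Unit where
  toFun _ := ()
  invFun _ := ⟨2, MuSym.mu⟩
  left_inv := by rintro ⟨_, ⟨⟩⟩; rfl
  right_inv _ := rfl

/-- The symbols `D_i` and `E_i` are coded by the two copies of `i` in `ω ⊕ ω`. -/
def hypSymEquiv : (Σ n, hypLang.Relations n) ≃ ℕ ⊕ ℕ where
  toFun R := match R with
    | ⟨_, HypSym.D i⟩ => Sum.inl i
    | ⟨_, HypSym.E i⟩ => Sum.inr i
  invFun := Sum.elim (fun i => ⟨2, HypSym.D i⟩) (fun i => ⟨2, HypSym.E i⟩)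
  left_inv := by rintro ⟨_, ⟨⟩⟩ <;> rfl
  right_inv := by rintro (_ | _) <;> rfl

instance ltSymPrimcodable : Primcodable (Σ n, ltLang.Relations n) := Primcodable.ofEquiv Unit ltSymEquiv

instance muSymPrimcodable : Primcodable (Σ n, muLang.Relations n) := Primcodable.ofEquiv Unit muSymEquiv

instance hypSymPrimcodable : Primcodable (Σ n, hypLang.Relations n) := Primcodable.ofEquiv (ℕ ⊕ ℕ) hypSymEquiv

instance sumSymPrimcodable {L₁ L₂ : FirstOrder.Language.{0, 0}} [Primcodable (Σ n, L₁.Relations n)]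
    [Primcodable (Σ n, L₂.Relations n)] : Primcodable (Σ n, (L₁.sum L₂).Relations n) :=
  Primcodable.ofEquiv _ (Equiv.sigmaSumDistrib L₁.Relations L₂.Relations)

end IsoSpectra

open IsoSpectra

/-! Each pair of orders codes one set. In `(ω, <_X)` the element `2a` is followed immediately by `2a
+ 2` unless `a ∈ X`. An isomorphism from `(ω, <)` respects immediate successors, so it computes `X`.
Conversely `X` computes the successor function of `<_X` and hence the isomorphism. So `IsoSpec (A n)
(B n)` is the cone above `deg (X n)` (`isoSpec_copies`).

The hypercube turns these spectra into a union (`isoSpec_structures`). An isomorphism `M ≅ N` maps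
`H` to itself and sends `∅` to some finite set `X`. If `X = ∅`, the component `A 0` of `M` at `∅` is
carried to the component `B 0` of `N` at `∅`. If `i ∈ X`, the relation `D_i` forces `(i, 0)` to go
to `(i, 1)`, so `A (i+1)` is carried to `B (i+1)`. Either way the isomorphism computes one of some
pair `A n ≅ B n`. Conversely, translation by `∅` or by the singleton `{n - 1}` makes the components
of `M` and `N` agree except at slot `n`, where `A n` and `B n` are exchanged
(`signN_translate_slotSet`). Thus a single isomorphism `A n ≅ B n` computes one from `M` to `N`.

A union of cones above an infinite antichain is not a finite union of cones, because every minimal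
degree `deg (X n)` must itself be a generator (`not_finitelyGenerated`). The antichain comes from a
Friedberg–Muchnik finite injury construction (`satisfied`, `incomparable`). It rests on the use
principle that a halting oracle computation reads only finitely much of the oracle
(`exists_approximates`). -/

namespace IsoSpectra

open Encodable

/-! ### Closure properties of computability relative to an oracle -/

section Oracle

variable {α β γ σ : Type} [Primcodable α] [Primcodable β] [Primcodable γ] [Primcodable σ]
variable {O : Set (ℕ →. ℕ)}

theorem computableIn_comp {f : β → σ} {g : α → β} (hf : ComputableIn O f) (hg : ComputableIn O g) :
    ComputableIn O fun a => f (g a) :=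
  (Nat.RecursiveIn.comp hf hg).of_eq fun n => by
    rcases e : decode (α := α) n with - | a <;> simp

theorem computableIn_pair {f : α → β} {g : α → γ} (hf : ComputableIn O f)
    (hg : ComputableIn O g) : ComputableIn O fun a => (f a, g a) :=
  (Nat.RecursiveIn.pair hf hg).of_eq fun n => by
    rcases e : decode (α := α) n with - | a <;> simp [Seq.seq]

theorem computableIn_of_comp {f : β → σ} {g : α → β} (hf : Computable f) (hg : ComputableIn O g) :
    ComputableIn O fun a => f (g a) :=
  computableIn_comp hf.computableIn hg

theorem computableIn_of_comp₂ {f : β → γ → σ} {g : α → β} {h : α → γ} (hf : Computable₂ f)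
    (hg : ComputableIn O g) (hh : ComputableIn O h) : ComputableIn O fun a => f (g a) (h a) :=
  computableIn_comp (f := fun p : β × γ => f p.1 p.2) (Computable.computableIn hf)
    (computableIn_pair hg hh)

theorem computableIn_cond {c : α → Bool} {f g : α → σ} (hc : ComputableIn O c)
    (hf : ComputableIn O f) (hg : ComputableIn O g) :
    ComputableIn O fun a => bif c a then f a else g a :=
  computableIn_comp (f := fun p : Bool × σ × σ => bif p.1 then p.2.1 else p.2.2)
    (Computable.computableIn (Computable.cond Computable.fst (Computable.fst.comp Computable.snd)
      (Computable.snd.comp Computable.snd)))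
    (computableIn_pair hc (computableIn_pair hf hg))

/-- Unbounded search relative to an oracle. -/
theorem computableIn_find {P : α → ℕ → Prop} [DecidableRel P]
    (hP : ComputableIn O fun p : α × ℕ => decide (P p.1 p.2)) (h : ∀ a, ∃ n, P a n) :
    ComputableIn O fun a => Nat.find (h a) := by
  -- Minimization looks for a zero, so truth is coded by `0`.
  have h1 : ComputableIn O fun p : α × ℕ => bif decide (P p.1 p.2) then 0 else 1 :=
    computableIn_cond hP (ComputableIn.const 0) (ComputableIn.const 1)
  have h2 := Nat.RecursiveIn.rfind h1
  have h3 : ComputableIn O (encode : α → ℕ) := Computable.computableIn Computable.encode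
  refine (Nat.RecursiveIn.comp h2 h3).of_eq fun n => ?_
  rcases e : decode (α := α) n with - | a
  · simp
  · simp only [Part.coe_some, Part.bind_some, Part.bind_eq_bind, Part.map_some]
    rw [Part.eq_some_iff]
    refine Nat.mem_rfind.2 ⟨?_, fun {m} hm => ?_⟩
    · simp [Nat.find_spec (h a)]
    · simp [Nat.find_min (h a) hm]

theorem computableIn_natRec (a : σ) {h : ℕ × σ → σ} (hh : ComputableIn O h) :
    ComputableIn O fun n => Nat.rec (motive := fun _ => σ) a (fun k b => h (k, b)) n := by
  have h0 : Nat.RecursiveIn O fun _ => Part.some (encode a) :=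
    RecursiveIn.iff_nat.1 (ComputableIn.const (encode a))
  have h1 := computableIn_comp hh (Computable.computableIn (O := O)
    (Computable.snd : Computable (@Prod.snd ℕ (ℕ × σ))))
  -- The recursion scheme carries a parameter: it is given the dummy value `0`, which `h1` discards.
  have h2 : Nat.RecursiveIn O fun n : ℕ => Part.some (Nat.pair 0 n) :=
    Nat.Partrec.recursiveIn
      (Partrec.nat_iff.1 (Primrec₂.natPair.comp (Primrec.const 0) Primrec.id).to_comp)
  refine (Nat.RecursiveIn.comp (Nat.RecursiveIn.prec h0 h1) h2).of_eq fun n => ?_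
  simp only [Part.bind_eq_bind, Part.bind_some, Nat.unpair_pair, decode_nat, Part.coe_some,
    Part.map_some]
  induction n with
  | zero => simp
  | succ n ih => dsimp only; rw [ih]; simp

/-- Preimages are found by search, which terminates by surjectivity. -/
theorem computableIn_symm {f : ℕ ≃ ℕ} (hf : ComputableIn O f) : ComputableIn O f.symm := by
  have h : ∀ b, ∃ n, f n = b := f.surjective
  have := computableIn_find (O := O) (P := fun b n => f n = b)
    (computableIn_of_comp₂ (f := fun (p q : ℕ) => decide (p = q)) Primrec.eq.decide.to_comp
      (computableIn_comp hf ComputableIn.snd) ComputableIn.fst) h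
  convert this using 2 with b
  rw [Equiv.symm_apply_eq, Nat.find_spec (h b)]

theorem computableIn_mono {f : α → σ} {g h : ℕ →. ℕ} (hf : ComputableIn {g} f)
    (hgh : TuringReducible g h) : ComputableIn {h} f :=
  Nat.RecursiveIn.subst hf (by simpa [RecursiveIn.iff_nat] using hgh)

end Oracle

open scoped Classical in
theorem setReducible_iff {X Y : Set ℕ} :
    SetReducible X Y ↔ ComputableIn {chi Y} fun n => decide (n ∈ X) := by
  have e : SetReducible X Y ↔ ComputableIn {chi Y} fun n => if n ∈ X then 1 else 0 := Iff.rfl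
  rw [e]
  constructor
  · intro h
    convert computableIn_of_comp₂ (f := fun (p q : ℕ) => decide (p = q)) Primrec.eq.decide.to_comp
      h (ComputableIn.const 1) using 2 with n
    by_cases hn : n ∈ X <;> simp [hn]
  · intro h
    convert computableIn_cond h (ComputableIn.const 1) (ComputableIn.const 0) using 2 with n
    by_cases hn : n ∈ X <;> simp [hn]

/-- The choice of a representative is immaterial, since representatives of one degree compute each
other. -/
theorem computableFrom_deg_iff {M N : Type} [Primcodable M] [Primcodable N] {f : M → N}
    {X : Set ℕ} : ComputableFrom f (deg X) ↔ ComputableIn {chi X} f := by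
  constructor
  · rintro ⟨Y, hY, h⟩
    exact computableIn_mono h (deg_le_deg_iff Y X |>.1 hY.le)
  · exact fun h => ⟨X, rfl, h⟩

/-! ### Oracle computations use finitely much of the oracle -/

/-- The initial segment of length `ℓ` of the total oracle `g`. -/
def initialSegment (g : ℕ → ℕ) (ℓ : ℕ) : List ℕ := (List.range ℓ).map g

/-- The function with finite oracle `F` approximates `f`, along the initial segments of `g`. -/
def Approximates (g : ℕ → ℕ) (F : List ℕ × ℕ →. ℕ) (f : ℕ →. ℕ) : Prop :=
  (∀ ℓ a y, y ∈ F (initialSegment g ℓ, a) → y ∈ f a) ∧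
    ∀ a y, y ∈ f a → ∀ᶠ ℓ in Filter.atTop, y ∈ F (initialSegment g ℓ, a)

theorem approximates_of_total (g : ℕ → ℕ) (f : ℕ →. ℕ) : Approximates g (fun p => f p.2) f :=
  ⟨fun _ _ _ h => h, fun _ _ h => Filter.Eventually.of_forall fun _ => h⟩

theorem Approximates.comp {g : ℕ → ℕ} {F H : List ℕ × ℕ →. ℕ} {f h : ℕ →. ℕ}
    (hF : Approximates g F f) (hH : Approximates g H h) :
    Approximates g (fun p => (H p).bind fun z => F (p.1, z)) fun n => h n >>= f := by
  constructor
  · intro ℓ a y hy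
    obtain ⟨z, hz, hy⟩ := Part.mem_bind_iff.1 hy
    exact Part.mem_bind_iff.2 ⟨z, hH.1 _ _ _ hz, hF.1 _ _ _ hy⟩
  · intro a y hy
    obtain ⟨z, hz, hy⟩ := Part.mem_bind_iff.1 hy
    filter_upwards [hH.2 _ _ hz, hF.2 _ _ hy] with ℓ h1 h2
    exact Part.mem_bind_iff.2 ⟨z, h1, h2⟩

theorem Approximates.pair {g : ℕ → ℕ} {F H : List ℕ × ℕ →. ℕ} {f h : ℕ →. ℕ}
    (hF : Approximates g F f) (hH : Approximates g H h) :
    Approximates g (fun p => (F p).bind fun u => (H p).map fun v => Nat.pair u v)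
      fun n => Nat.pair <$> f n <*> h n := by
  have key : ∀ (P Q : Part ℕ) (y : ℕ),
      y ∈ (Nat.pair <$> P <*> Q) ↔ ∃ u ∈ P, ∃ v ∈ Q, Nat.pair u v = y := by
    intro P Q y
    simp [Seq.seq]
  have key' : ∀ (P Q : Part ℕ) (y : ℕ),
      (y ∈ P.bind fun u => Q.map fun v => Nat.pair u v) ↔ ∃ u ∈ P, ∃ v ∈ Q, Nat.pair u v = y := by
    intro P Q y
    simp
  constructor
  · intro ℓ a y hy
    obtain ⟨u, hu, v, hv, hy⟩ := (key' _ _ _).1 hy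
    exact (key _ _ _).2 ⟨u, hF.1 _ _ _ hu, v, hH.1 _ _ _ hv, hy⟩
  · intro a y hy
    obtain ⟨u, hu, v, hv, hy⟩ := (key _ _ _).1 hy
    filter_upwards [hF.2 _ _ hu, hH.2 _ _ hv] with ℓ h1 h2
    exact (key' _ _ _).2 ⟨u, h1, v, h2, hy⟩

theorem Approximates.prec {g : ℕ → ℕ} {F H : List ℕ × ℕ →. ℕ} {f h : ℕ →. ℕ}
    (hF : Approximates g F f) (hH : Approximates g H h) :
    Approximates g
      (fun p => p.2.unpair.2.rec (F (p.1, p.2.unpair.1)) fun y IH =>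
        IH.bind fun i => H (p.1, Nat.pair p.2.unpair.1 (Nat.pair y i)))
      (fun p =>
        let (a, n) := Nat.unpair p
        n.rec (f a) fun y IH => do
          let i ← IH
          h (Nat.pair a (Nat.pair y i))) := by
  constructor
  · intro ℓ a
    dsimp only
    induction a.unpair.2 with
    | zero => exact fun y => hF.1 _ _ _
    | succ n ih =>
      intro y hy
      obtain ⟨i, hi, hy⟩ := Part.mem_bind_iff.1 hy
      exact Part.mem_bind_iff.2 ⟨i, ih i hi, hH.1 _ _ _ hy⟩
  · intro a
    dsimp only
    induction a.unpair.2 with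
    | zero => exact fun y => hF.2 _ _
    | succ n ih =>
      intro y hy
      obtain ⟨i, hi, hy⟩ := Part.mem_bind_iff.1 hy
      filter_upwards [ih i hi, hH.2 _ _ hy] with ℓ h1 h2
      exact Part.mem_bind_iff.2 ⟨i, h1, h2⟩

theorem Approximates.rfind {g : ℕ → ℕ} {F : List ℕ × ℕ →. ℕ} {f : ℕ →. ℕ}
    (hF : Approximates g F f) :
    Approximates g
      (fun p => Nat.rfind fun n => (F (p.1, Nat.pair p.2 n)).map fun m => decide (m = 0))
      fun a => Nat.rfind fun n => (fun m => decide (m = 0)) <$> f (Nat.pair a n) := by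
  have mem : ∀ ℓ a n b, b ∈ ((F (initialSegment g ℓ, Nat.pair a n)).map fun m => decide (m = 0)) →
      b ∈ (fun m => decide (m = 0)) <$> f (Nat.pair a n) := by
    intro ℓ a n b hb
    obtain ⟨m, hm, rfl⟩ := (Part.mem_map_iff _).1 hb
    exact (Part.mem_map_iff _).2 ⟨m, hF.1 _ _ _ hm, rfl⟩
  have ev : ∀ a n b, b ∈ (fun m => decide (m = 0)) <$> f (Nat.pair a n) →
      ∀ᶠ ℓ in Filter.atTop,
        b ∈ ((F (initialSegment g ℓ, Nat.pair a n)).map fun m => decide (m = 0)) := by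
    intro a n b hb
    obtain ⟨m, hm, rfl⟩ := (Part.mem_map_iff _).1 hb
    filter_upwards [hF.2 _ _ hm] with ℓ h
    exact (Part.mem_map_iff _).2 ⟨m, h, rfl⟩
  constructor
  · intro ℓ a y hy
    obtain ⟨h1, h2⟩ := Nat.mem_rfind.1 hy
    exact Nat.mem_rfind.2 ⟨mem _ _ _ _ h1, fun hm => mem _ _ _ _ (h2 hm)⟩
  · intro a y hy
    obtain ⟨h1, h2⟩ := Nat.mem_rfind.1 hy
    -- A successful search evaluates `f` at finitely many arguments only, so one initial segment of
    -- the oracle eventually serves them all.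
    filter_upwards [ev _ _ _ h1, (Filter.eventually_all_finite (Set.finite_lt_nat y)).2
      fun m hm => ev _ _ _ (h2 hm)] with ℓ h3 h4
    exact Nat.mem_rfind.2 ⟨h3, fun {m} hm => h4 m hm⟩

section

variable {F H : List ℕ × ℕ →. ℕ}

theorem partrec_pair (pF : Partrec F) (pH : Partrec H) :
    Partrec fun p => (F p).bind fun u => (H p).map fun v => Nat.pair u v :=
  Partrec.bind pF (Partrec.map (pH.comp Computable.fst)
    (Primrec₂.natPair.to_comp.comp (Computable.snd.comp Computable.fst) Computable.snd))

theorem partrec_comp (pF : Partrec F) (pH : Partrec H) :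
    Partrec fun p : List ℕ × ℕ => (H p).bind fun z => F (p.1, z) :=
  Partrec.bind pH (pF.comp ((Computable.fst.comp Computable.fst).pair Computable.snd))

theorem partrec_prec (pF : Partrec F) (pH : Partrec H) :
    Partrec fun p : List ℕ × ℕ =>
      (p.2.unpair.2.rec (F (p.1, p.2.unpair.1)) fun y IH =>
        IH.bind fun i => H (p.1, Nat.pair p.2.unpair.1 (Nat.pair y i)) : Part ℕ) := by
  have h1 : Computable fun p : List ℕ × ℕ => p.2.unpair.1 :=
    Computable.fst.comp (Computable.unpair.comp Computable.snd)
  have h2 : Computable fun p : List ℕ × ℕ => p.2.unpair.2 :=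
    Computable.snd.comp (Computable.unpair.comp Computable.snd)
  refine Partrec.nat_rec h2 (pF.comp (Computable.fst.pair h1))
    (h := fun p q => H (p.1, Nat.pair p.2.unpair.1 (Nat.pair q.1 q.2))) ?_
  exact pH.comp ((Computable.fst.comp Computable.fst).pair (Primrec₂.natPair.to_comp.comp
    (h1.comp Computable.fst) (Primrec₂.natPair.to_comp.comp (Computable.fst.comp Computable.snd)
      (Computable.snd.comp Computable.snd))))

theorem partrec_rfind (pF : Partrec F) :
    Partrec fun p : List ℕ × ℕ =>
      Nat.rfind fun n => (F (p.1, Nat.pair p.2 n)).map fun m => decide (m = 0) := by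
  have h1 : Partrec₂ fun (p : List ℕ × ℕ) (n : ℕ) => F (p.1, Nat.pair p.2 n) :=
    pF.comp ((Computable.fst.comp Computable.fst).pair (Primrec₂.natPair.to_comp.comp
      (Computable.snd.comp Computable.fst) Computable.snd))
  have h2 : Computable fun m : ℕ => decide (m = 0) :=
    (Primrec.eq.decide.comp Primrec.id (Primrec.const 0)).to_comp
  exact Partrec.rfind (Partrec.map h1 (h2.comp Computable.snd))

end

/-- The use principle, by induction on the derivation of recursiveness. The oracle becomes a finite
list in the input, so that ordinary codes enumerate all reductions. -/
theorem exists_approximates {g : ℕ → ℕ} {f : ℕ →. ℕ}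
    (h : Nat.RecursiveIn {fun n => Part.some (g n)} f) :
    ∃ F : List ℕ × ℕ →. ℕ, Partrec F ∧ Approximates g F f := by
  have snd : Computable (Prod.snd : List ℕ × ℕ → ℕ) := Computable.snd
  induction h with
  | zero => exact ⟨_, (Partrec.nat_iff.2 Nat.Partrec.zero).comp snd, approximates_of_total g _⟩
  | succ => exact ⟨_, (Partrec.nat_iff.2 Nat.Partrec.succ).comp snd, approximates_of_total g _⟩
  | left => exact ⟨_, (Partrec.nat_iff.2 Nat.Partrec.left).comp snd, approximates_of_total g _⟩
  | right => exact ⟨_, (Partrec.nat_iff.2 Nat.Partrec.right).comp snd, approximates_of_total g _⟩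
  | oracle f hf =>
    obtain rfl := Set.mem_singleton_iff.1 hf
    -- A query beyond the end of the list diverges; this keeps every answer given correct.
    refine ⟨fun p => (p.1[p.2]? : Option ℕ),
      Computable.ofOption (Computable.list_getElem?.comp Computable.fst Computable.snd), ?_, ?_⟩
    · intro ℓ a y hy
      simp [initialSegment, Option.map_eq_some_iff, List.getElem?_eq_some_iff] at hy ⊢
      exact hy.2.symm
    · intro a y hy
      filter_upwards [Filter.eventually_gt_atTop a] with ℓ hℓ
      simp [initialSegment, hℓ] at hy ⊢
      exact hy
  | pair _ _ ihf ihh =>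
    obtain ⟨F, pF, hF⟩ := ihf
    obtain ⟨H, pH, hH⟩ := ihh
    exact ⟨_, partrec_pair pF pH, hF.pair hH⟩
  | comp _ _ ihf ihh =>
    obtain ⟨F, pF, hF⟩ := ihf
    obtain ⟨H, pH, hH⟩ := ihh
    exact ⟨_, partrec_comp pF pH, hF.comp hH⟩
  | prec _ _ ihf ihh =>
    obtain ⟨F, pF, hF⟩ := ihf
    obtain ⟨H, pH, hH⟩ := ihh
    exact ⟨_, partrec_prec pF pH, hF.prec hH⟩
  | rfind _ ihf =>
    obtain ⟨F, pF, hF⟩ := ihf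
    exact ⟨_, partrec_rfind pF, hF.rfind⟩

open scoped Classical in
/-- The characteristic function of a set of natural numbers. -/
noncomputable def indicator (X : Set ℕ) (n : ℕ) : ℕ := if n ∈ X then 1 else 0

open Nat.Partrec (Code) in
-- The equivalence is the form that diagonalization refutes: either `0` is output at an element of
-- `X`, or `0` is never output at a non-element.
theorem exists_code_of_setReducible {X Y : Set ℕ} (h : SetReducible X Y) :
    ∃ c : Code, ∀ a y, indicator X a = y ↔
      ∃ ℓ, y ∈ c.eval (encode (initialSegment (indicator Y) ℓ, a)) := by
  obtain ⟨F, pF, h1, h2⟩ := exists_approximates (g := indicator Y) (RecursiveIn.iff_nat.1 h)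
  obtain ⟨c, hc⟩ := Code.exists_code.1 pF
  refine ⟨c, fun a y => ?_⟩
  have e : ∀ p, c.eval (encode p) = F p := fun p => by
    rw [hc]
    dsimp only
    rw [encodek, Part.coe_some, Part.bind_some]
    exact Part.map_id' (fun _ => rfl) _
  simp only [e]
  have e' : indicator X a = y ↔ y ∈ chi X a := by simp [chi, indicator, eq_comm]
  rw [e']
  exact ⟨fun hy => (h2 a y hy).exists, fun ⟨ℓ, hℓ⟩ => h1 ℓ a y hℓ⟩

/-! ### Infinitely many pairwise incomparable c.e. degrees: a finite injury construction

The requirement `i` says that the program `program i` does not compute the set `target i` from the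
oracle set `source i`. It diagonalizes at numbers `x` with `x.unpair.1 = i`. -/

open Nat.Partrec (Code)

namespace Requirement

/-- The program of a requirement. -/
def program (i : ℕ) : Code := Denumerable.ofNat Code i.unpair.1

/-- The index of the set to be computed. -/
def target (i : ℕ) : ℕ := i.unpair.2.unpair.1

/-- The index of the oracle set. -/
def source (i : ℕ) : ℕ := i.unpair.2.unpair.2

/-- A state consists of the list of the numbers enumerated so far, and of the list of the pairs of
an active requirement and the length of the initial segment of its source that it protects. -/
abbrev State : Type := List ℕ × List (ℕ × ℕ)

/-- The initial segment of length `ℓ` of the set with index `n`, given by the list of all numbers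
enumerated. -/
def approx (L : List ℕ) (n ℓ : ℕ) : List ℕ :=
  (List.range ℓ).map fun z => if z ∈ L ∧ target z.unpair.1 = n then 1 else 0

/-- The witness examined at stage `s`. -/
def witness (s : ℕ) : ℕ := s.unpair.2.unpair.1

/-- The length of the initial segment of the oracle examined at stage `s`. -/
def use (s : ℕ) : ℕ := s.unpair.2.unpair.2

/-- The requirement examined at stage `s`. -/
def index (s : ℕ) : ℕ := (witness s).unpair.1

/-- The condition under which the requirement `index s` acts at stage `s`. -/
def Acts (st : State) (s : ℕ) : Prop :=
  -- Smaller index means higher priority: an active requirement of smaller index forbids witnesses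
  -- below the length it protects.
  (∀ p ∈ st.2, p.1 ≠ index s ∧ (p.1 < index s → p.2 ≤ witness s)) ∧
    target (index s) ≠ source (index s) ∧
    Code.evaln s (program (index s))
      (encode (approx st.1 (source (index s)) (use s), witness s)) = some 0

instance (st : State) (s : ℕ) : Decidable (Acts st s) := by unfold Acts; infer_instance

/-- The state after the action of the requirement `index s`. -/
def act (st : State) (s : ℕ) : State :=
  -- Active requirements of lower priority are injured: the new number may lie in the segment they
  -- protect.
  (witness s :: st.1, (index s, use s) :: st.2.filter fun p => p.1 < index s)

/-- The state before stage `s`. -/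
def state (s : ℕ) : State :=
  Nat.rec (motive := fun _ => State) ([], []) (fun s st => if Acts st s then act st s else st) s

theorem state_succ_of_acts {s : ℕ} (h : Acts (state s) s) : state (s + 1) = act (state s) s :=
  if_pos h

theorem state_succ_of_not_acts {s : ℕ} (h : ¬ Acts (state s) s) : state (s + 1) = state s :=
  if_neg h

/-- The sets constructed. -/
def set (n : ℕ) : Set ℕ := {x | (∃ s, x ∈ (state s).1) ∧ target x.unpair.1 = n}

theorem enumerated_mono {s t : ℕ} (h : s ≤ t) : (state s).1 ⊆ (state t).1 := by
  induction h with
  | refl => exact List.Subset.refl _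
  | @step t _ ih =>
    refine List.Subset.trans ih ?_
    by_cases ha : Acts (state t) t
    · rw [state_succ_of_acts ha]; exact List.subset_cons_self _ _
    · rw [state_succ_of_not_acts ha]; exact List.Subset.refl _

theorem approx_congr {L L' : List ℕ} {n ℓ : ℕ}
    (h : ∀ z < ℓ, target z.unpair.1 = n → (z ∈ L ↔ z ∈ L')) : approx L n ℓ = approx L' n ℓ := by
  refine List.map_congr_left fun z hz => ?_
  have := h z (List.mem_range.1 hz)
  by_cases hn : target z.unpair.1 = n <;> simp_all

/-- Numbers are never removed, so membership of each of the finitely many `z < ℓ` settles. -/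
theorem approx_eventually (n ℓ : ℕ) :
    ∃ s₀, ∀ s ≥ s₀, approx (state s).1 n ℓ = initialSegment (indicator (set n)) ℓ := by
  have h : ∀ᶠ s in Filter.atTop, ∀ z ∈ {z | z < ℓ},
      ((z ∈ (state s).1 ∧ target z.unpair.1 = n) ↔ z ∈ set n) := by
    refine (Filter.eventually_all_finite (Set.finite_lt_nat ℓ)).2 fun z _ => ?_
    by_cases hz : ∃ s, z ∈ (state s).1
    · obtain ⟨s, hs⟩ := hz
      filter_upwards [Filter.eventually_ge_atTop s] with t ht
      exact and_congr_left fun _ => ⟨fun h => ⟨t, h⟩, fun _ => enumerated_mono ht hs⟩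
    · exact Filter.Eventually.of_forall fun t =>
        and_congr_left fun _ => ⟨fun h => ⟨t, h⟩, fun h => absurd h hz⟩
  obtain ⟨s₀, h₀⟩ := Filter.eventually_atTop.1 h
  refine ⟨s₀, fun s hs => List.map_congr_left fun z hz => ?_⟩
  have := h₀ s hs z (List.mem_range.1 hz)
  simp only [indicator]
  split_ifs <;> tauto

/-- Active requirements are satisfied by the current approximation. -/
theorem active_satisfied (s : ℕ) : ∀ p ∈ (state s).2, target p.1 ≠ source p.1 ∧
    ∃ x ∈ (state s).1, x.unpair.1 = p.1 ∧
      0 ∈ (program p.1).eval (encode (approx (state s).1 (source p.1) p.2, x)) := by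
  induction s with
  | zero => intro p hp; simp [state] at hp
  | succ s ih =>
    by_cases ha : Acts (state s) s
    · rw [state_succ_of_acts ha]
      intro p hp
      rcases List.mem_cons.1 hp with rfl | hp
      · refine ⟨ha.2.1, witness s, List.mem_cons_self, rfl, ?_⟩
        rw [show approx (act (state s) s).1 (source (index s)) (use s) =
          approx (state s).1 (source (index s)) (use s) from approx_congr fun z _ hz => ?_]
        · exact Code.evaln_sound ha.2.2
        · have : z ≠ witness s := by
            rintro rfl
            exact ha.2.1 hz
          simp [act, this]
      · obtain ⟨hp, hlt⟩ := List.mem_filter.1 hp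
        obtain ⟨h1, x, hx, h2, h3⟩ := ih p hp
        refine ⟨h1, x, List.mem_cons_of_mem _ hx, h2, ?_⟩
        rwa [show approx (act (state s) s).1 (source p.1) p.2 =
          approx (state s).1 (source p.1) p.2 from approx_congr fun z hz _ => ?_]
        -- The restraint of the surviving requirement puts the new witness outside its protected
        -- segment.
        have := (ha.1 p hp).2 (by simpa using hlt)
        have : z ≠ witness s := by omega
        simp [act, this]
    · rwa [state_succ_of_not_acts ha]

/-- An action of index above `i` adds a pair of that index and removes only pairs of at least that
index. The converse direction shows that nothing of index at most `i` becomes active after `s₀`. -/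
theorem active_persists {i s₀ : ℕ} (h : ∀ s ≥ s₀, Acts (state s) s → ¬ index s ≤ i) {p : ℕ × ℕ}
    (hi : p.1 ≤ i) {s t : ℕ} (hs : s₀ ≤ s) (hst : s ≤ t) :
    p ∈ (state s).2 ↔ p ∈ (state t).2 := by
  induction hst with
  | refl => rfl
  | @step t hst ih =>
    rw [ih]
    by_cases ha : Acts (state t) t
    · have := h t (hs.trans hst) ha
      rw [state_succ_of_acts ha]
      have h1 : p ≠ (index t, use t) := by rintro rfl; exact this hi
      have h2 : p.1 < index t := by omega
      simp [act, h1, h2]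
    · rw [state_succ_of_not_acts ha]

/-- Every requirement acts finitely often. -/
theorem finite_injury (i : ℕ) : ∃ s₀, ∀ s ≥ s₀, Acts (state s) s → index s ≠ i := by
  induction i using Nat.strong_induction_on with
  | _ i ih =>
    obtain ⟨s₁, h₁⟩ : ∃ s₁, ∀ s ≥ s₁, ∀ j ∈ {j | j < i}, Acts (state s) s → index s ≠ j :=
      Filter.eventually_atTop.1 ((Filter.eventually_all_finite (Set.finite_lt_nat i)).2
        fun j hj => Filter.eventually_atTop.2 (ih j hj))
    by_cases hex : ∃ s ≥ s₁, Acts (state s) s ∧ index s = i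
    · obtain ⟨s, hs, ha, rfl⟩ := hex
      -- Once the smaller indices are quiet, an action makes the requirement permanently active, and
      -- an active requirement does not act.
      have key : ∀ t ≥ s + 1, (index s, use s) ∈ (state t).2 := by
        intro t ht
        induction ht with
        | refl => rw [state_succ_of_acts ha]; exact List.mem_cons_self
        | @step t ht ih' =>
          by_cases hb : Acts (state t) t
          · have h2 := (hb.1 _ ih').1
            have h3 := h₁ t (by have : s + 1 ≤ t := ht; omega) (index t)
            have h4 : index s < index t := by
              by_contra hlt
              exact h3 (show index t < index s by dsimp only at h2; omega) hb rfl
            rw [state_succ_of_acts hb]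
            exact List.mem_cons_of_mem _ (List.mem_filter.2 ⟨ih', by simpa using h4⟩)
          · rwa [state_succ_of_not_acts hb]
      exact ⟨s + 1, fun t ht hb heq => (hb.1 _ (key t ht)).1 heq.symm⟩
    · push Not at hex
      exact ⟨s₁, hex⟩

theorem finite_injury_le (i : ℕ) : ∃ s₀, ∀ s ≥ s₀, Acts (state s) s → ¬ index s ≤ i := by
  obtain ⟨s₀, h⟩ := Filter.eventually_atTop.1 ((Filter.eventually_all_finite
    (Set.finite_le_nat i)).2 fun j _ => Filter.eventually_atTop.2 (finite_injury j))
  exact ⟨s₀, fun s hs ha hle => h s hs (index s) hle ha rfl⟩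

/-- After `s₀` nothing of index at most `i` acts. If `i` is active at `s₀`, its computation with
output `0` survives to the true oracle, although its witness lies in the target. Otherwise a fresh
witness stays outside the target forever, and an output `0` there would make `i` act after `s₀`. -/
theorem satisfied (i : ℕ) (hi : target i ≠ source i) :
    ¬ ∀ a y, indicator (set (target i)) a = y ↔
      ∃ ℓ, y ∈ (program i).eval (encode (initialSegment (indicator (set (source i))) ℓ, a)) := by
  intro H
  obtain ⟨s₀, h₀⟩ := finite_injury_le i
  by_cases hact : ∃ p ∈ (state s₀).2, p.1 = i
  · obtain ⟨p, hp, rfl⟩ := hact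
    obtain ⟨s₁, h₁⟩ := approx_eventually (source p.1) p.2
    have hp' : p ∈ (state (max s₀ s₁)).2 :=
      (active_persists h₀ le_rfl le_rfl (le_max_left _ _)).1 hp
    obtain ⟨-, x, hx, hxi, he⟩ := active_satisfied _ p hp'
    rw [h₁ _ (le_max_right _ _)] at he
    have h2 := (H x 0).2 ⟨_, he⟩
    have h3 : x ∈ set (target p.1) := ⟨⟨_, hx⟩, by rw [hxi]⟩
    simp [indicator, h3] at h2
  · push Not at hact
    -- The witness `Nat.pair i t ≥ t` will respect all restraints at `s₀` and be new at `s₀`.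
    obtain ⟨t, ht₁, ht₂⟩ : ∃ t, (∀ p ∈ (state s₀).2, p.2 ≤ t) ∧ ∀ y ∈ (state s₀).1, y < t := by
      have e1 : ∀ᶠ t in Filter.atTop, ∀ p ∈ {p | p ∈ (state s₀).2}, p.2 ≤ t :=
        (Filter.eventually_all_finite (List.finite_toSet _)).2
          fun p _ => Filter.eventually_ge_atTop _
      have e2 : ∀ᶠ t in Filter.atTop, ∀ y ∈ {y | y ∈ (state s₀).1}, y < t :=
        (Filter.eventually_all_finite (List.finite_toSet _)).2
          fun y _ => Filter.eventually_gt_atTop _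
      exact (e1.and e2).exists
    set x := Nat.pair i t with hx
    have hxt : t ≤ x := Nat.right_le_pair _ _
    have hxi : x.unpair.1 = i := by simp [hx]
    have hnot : ∀ s ≥ s₀, x ∉ (state s).1 := by
      intro s hs
      induction hs with
      | refl => exact fun h => absurd (ht₂ x h) (by omega)
      | @step s hs ih =>
        by_cases ha : Acts (state s) s
        · rw [state_succ_of_acts ha]
          intro h
          rcases List.mem_cons.1 h with h | h
          · exact h₀ s hs ha (by rw [index, ← h, hxi])
          · exact ih h
        · rwa [state_succ_of_not_acts ha]
    have hout : x ∉ set (target i) := fun ⟨⟨s, hs⟩, _⟩ =>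
      hnot (max s s₀) (le_max_right _ _) (enumerated_mono (le_max_left _ _) hs)
    obtain ⟨ℓ, hℓ⟩ := (H x 0).1 (by simp [indicator, hout])
    obtain ⟨k, hk⟩ := Code.evaln_complete.1 hℓ
    obtain ⟨s₁, h₁⟩ := approx_eventually (source i) ℓ
    -- The stage codes witness and use; its first entry makes it late enough for quiet (`s₀`), for
    -- halting (`k`) and for a correct oracle segment (`s₁`).
    set s := Nat.pair (max s₀ (max k s₁)) (Nat.pair x ℓ) with hs
    have hle : max s₀ (max k s₁) ≤ s := Nat.left_le_pair _ _
    have hw : witness s = x := by simp [witness, hs]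
    have hu : use s = ℓ := by simp [use, hs]
    have hidx : index s = i := by rw [index, hw, hxi]
    refine h₀ s (by omega) ⟨fun p hp => ?_, ?_, ?_⟩ hidx.le
    · rw [hidx, hw]
      constructor
      · exact fun h => hact p
          ((active_persists h₀ h.le le_rfl (by omega)).2 hp) h
      · exact fun h => (ht₁ p
          ((active_persists h₀ h.le le_rfl (by omega)).2 hp)).trans hxt
    · rwa [hidx]
    · rw [hidx, hw, hu, h₁ s (by omega)]
      exact Code.evaln_mono (by omega) hk

theorem incomparable {m n : ℕ} (h : m ≠ n) : ¬ deg (set m) ≤ deg (set n) := by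
  intro hle
  obtain ⟨c, hc⟩ := exists_code_of_setReducible ((deg_le_deg_iff _ _).1 hle)
  have := satisfied (Nat.pair (encode c) (Nat.pair m n))
  simp only [target, source, program, Nat.unpair_pair, Denumerable.ofNat_encode] at this
  exact this h hc

/-! The construction is computable. -/

theorem primrec_fst_unpair : Primrec fun n : ℕ => n.unpair.1 := Primrec.fst.comp Primrec.unpair

theorem primrec_snd_unpair : Primrec fun n : ℕ => n.unpair.2 := Primrec.snd.comp Primrec.unpair

theorem primrec_program : Primrec program := (Primrec.ofNat Code).comp primrec_fst_unpair

theorem primrec_target : Primrec target := primrec_fst_unpair.comp primrec_snd_unpair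

theorem primrec_source : Primrec source := primrec_snd_unpair.comp primrec_snd_unpair

theorem primrec_witness : Primrec witness := primrec_fst_unpair.comp primrec_snd_unpair

theorem primrec_use : Primrec use := primrec_snd_unpair.comp primrec_snd_unpair

theorem primrec_index : Primrec index := primrec_fst_unpair.comp primrec_witness

theorem primrecRel_mem : PrimrecRel fun (L : List ℕ) (z : ℕ) => z ∈ L :=
  (PrimrecRel.exists_mem_list Primrec.eq).of_eq fun L z => by simp

theorem primrec_approx {α : Type} [Primcodable α] {L : α → List ℕ} {n ℓ : α → ℕ}
    (hL : Primrec L) (hn : Primrec n) (hℓ : Primrec ℓ) :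
    Primrec fun a => approx (L a) (n a) (ℓ a) := by
  refine Primrec.list_map (Primrec.list_range.comp hℓ) ?_
  refine Primrec.ite (PrimrecPred.and ?_ ?_) (Primrec.const 1) (Primrec.const 0)
  · exact primrecRel_mem.comp (hL.comp Primrec.fst) Primrec.snd
  · exact Primrec.eq.comp (primrec_target.comp (primrec_fst_unpair.comp Primrec.snd))
      (hn.comp Primrec.fst)

theorem primrec_evaln_comp {α : Type} [Primcodable α] {k n : α → ℕ} {c : α → Code}
    (hk : Primrec k) (hc : Primrec c) (hn : Primrec n) :
    Primrec fun a => Code.evaln (k a) (c a) (n a) :=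
  Code.primrec_evaln.comp ((hk.pair hc).pair hn)

theorem primrec_filter_index :
    Primrec₂ fun (R : List (ℕ × ℕ)) (s : ℕ) => R.filter fun p => p.1 < index s :=
  PrimrecRel.listFilter (R := fun (p : ℕ × ℕ) (s : ℕ) => p.1 < index s)
    (Primrec.nat_lt.comp (Primrec.fst.comp Primrec.fst) (primrec_index.comp Primrec.snd))

theorem primrecPred_acts : PrimrecPred fun p : State × ℕ => Acts p.1 p.2 := by
  have idx : Primrec fun p : State × ℕ => index p.2 := primrec_index.comp Primrec.snd
  have wit : Primrec fun p : State × ℕ => witness p.2 := primrec_witness.comp Primrec.snd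
  refine PrimrecPred.and ?_ (PrimrecPred.and (Primrec.eq.comp (primrec_target.comp idx)
    (primrec_source.comp idx)).not ?_)
  · have h : PrimrecRel fun (p : ℕ × ℕ) (s : ℕ) =>
        p.1 ≠ index s ∧ (¬ p.1 < index s ∨ p.2 ≤ witness s) :=
      PrimrecPred.and
        (Primrec.eq.comp (Primrec.fst.comp Primrec.fst) (primrec_index.comp Primrec.snd)).not
        ((Primrec.nat_lt.comp (Primrec.fst.comp Primrec.fst)
          (primrec_index.comp Primrec.snd)).not.or
          (Primrec.nat_le.comp (Primrec.snd.comp Primrec.fst) (primrec_witness.comp Primrec.snd)))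
    exact ((PrimrecRel.forall_mem_list h).comp (Primrec.snd.comp Primrec.fst) Primrec.snd).of_eq
      fun p => by simp only [imp_iff_not_or]
  · have h1 : Primrec fun p : State × ℕ => approx p.1.1 (source (index p.2)) (use p.2) :=
      primrec_approx (Primrec.fst.comp Primrec.fst) (primrec_source.comp idx)
        (primrec_use.comp Primrec.snd)
    have h2 : Primrec fun p : State × ℕ =>
        encode (approx p.1.1 (source (index p.2)) (use p.2), witness p.2) :=
      Primrec.encode.comp (h1.pair wit)
    have h3 : Primrec fun p : State × ℕ => Code.evaln p.2 (program (index p.2))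
        (encode (approx p.1.1 (source (index p.2)) (use p.2), witness p.2)) :=
      primrec_evaln_comp Primrec.snd (primrec_program.comp idx) h2
    exact Primrec.eq.comp h3 (Primrec.const _)

theorem primrec_act : Primrec₂ act := by
  have h1 : Primrec fun q : State × ℕ => q.1.2.filter fun p => p.1 < index q.2 :=
    primrec_filter_index.comp (Primrec.snd.comp Primrec.fst) Primrec.snd
  have h2 : Primrec fun q : State × ℕ => (index q.2, use q.2) :=
    (primrec_index.comp Primrec.snd).pair (primrec_use.comp Primrec.snd)
  have h3 : Primrec fun q : State × ℕ => witness q.2 :: q.1.1 :=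
    Primrec.list_cons.comp (primrec_witness.comp Primrec.snd) (Primrec.fst.comp Primrec.fst)
  have h4 : Primrec fun q : State × ℕ =>
      (index q.2, use q.2) :: q.1.2.filter fun p => p.1 < index q.2 :=
    Primrec.list_cons.comp h2 h1
  exact h3.pair h4

theorem primrec_state : Primrec state := by
  have h1 : PrimrecPred fun q : ℕ × State => Acts q.2 q.1 :=
    PrimrecPred.comp (p := fun p : State × ℕ => Acts p.1 p.2) (f := fun q : ℕ × State => (q.2, q.1))
      primrecPred_acts (Primrec.snd.pair Primrec.fst)
  have h2 : Primrec fun q : ℕ × State => act q.2 q.1 :=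
    Primrec₂.comp primrec_act Primrec.snd Primrec.fst
  exact Primrec.nat_rec₁ (f := fun s st => if Acts st s then act st s else st) ([], [])
    (Primrec.ite h1 h2 Primrec.snd)

end Requirement

/-- An existential quantifier over `ℕ` in front of a computable predicate. -/
theorem rePred_exists {α : Type} [Primcodable α] {P : α → ℕ → Prop}
    (h : ComputablePred fun p : α × ℕ => P p.1 p.2) : REPred fun a => ∃ n, P a n := by
  classical
  have h1 : Partrec fun a => Nat.rfind fun n => Part.some (decide (P a n)) :=
    Partrec.rfind h.decide.partrec
  refine h1.dom_re.of_eq fun a => ?_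
  refine Nat.rfind_dom.trans ?_
  simp

open Requirement in
theorem exists_incomparable :
    ∃ X : ℕ → Set ℕ, UniformlyCE X ∧ Pairwise fun m n => ¬ deg (X m) ≤ deg (X n) := by
  refine ⟨Requirement.set, ?_, fun m n h => incomparable h⟩
  have h : PrimrecPred fun q : (ℕ × ℕ) × ℕ =>
      q.1.2 ∈ (state q.2).1 ∧ target q.1.2.unpair.1 = q.1.1 :=
    (primrecRel_mem.comp (Primrec.fst.comp (primrec_state.comp Primrec.snd))
      (Primrec.snd.comp Primrec.fst)).and (Primrec.eq.comp
        (primrec_target.comp (primrec_fst_unpair.comp (Primrec.snd.comp Primrec.fst)))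
        (Primrec.fst.comp Primrec.fst))
  exact (rePred_exists (P := fun (p : ℕ × ℕ) s =>
    p.2 ∈ (state s).1 ∧ target p.2.unpair.1 = p.1) h.computablePred).of_eq fun p => by
      simp [Requirement.set]

/-! ### Enumerations without repetitions -/

/-- Infinite uniformly computable sets have uniformly computable increasing enumerations. -/
theorem exists_computable_enumeration {P : ℕ → ℕ → Prop}
    (hP : ComputablePred fun p : ℕ × ℕ => P p.1 p.2) (hinf : ∀ n b, ∃ s, b ≤ s ∧ P n s) :
    ∃ e : ℕ → ℕ → ℕ, Computable₂ e ∧ ∀ n, StrictMono (e n) ∧ Set.range (e n) = {s | P n s} := by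
  classical
  have hinf' : ∀ q : ℕ × ℕ, ∃ s, q.2 ≤ s ∧ P q.1 s := fun q => hinf q.1 q.2
  have hQ : ComputablePred fun p : (ℕ × ℕ) × ℕ => p.1.2 ≤ p.2 ∧ P p.1.1 p.2 := by
    refine Computable.computablePred ?_
    have h1 : Computable fun p : (ℕ × ℕ) × ℕ => decide (p.1.2 ≤ p.2) :=
      (Primrec.nat_le.decide.comp (Primrec.snd.comp Primrec.fst) Primrec.snd).to_comp
    have h2 : Computable fun p : (ℕ × ℕ) × ℕ => decide (P p.1.1 p.2) :=
      hP.decide.comp ((Computable.fst.comp Computable.fst).pair Computable.snd)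
    exact (Primrec.and.to_comp.comp h1 h2).of_eq fun p => by simp
  set next : ℕ × ℕ → ℕ := fun q => Nat.find (hinf' q) with hnext
  have next_computable : Computable next :=
    Computable.find (P := fun (q : ℕ × ℕ) s => q.2 ≤ s ∧ P q.1 s) hQ hinf'
  have next_spec : ∀ n b, b ≤ next (n, b) ∧ P n (next (n, b)) := fun n b => Nat.find_spec (hinf' (n, b))
  have next_min : ∀ n b s, b ≤ s → P n s → next (n, b) ≤ s :=
    fun n b s h1 h2 => Nat.find_min' (hinf' (n, b)) ⟨h1, h2⟩
  let e : ℕ → ℕ → ℕ := fun n j =>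
    Nat.rec (motive := fun _ => ℕ) (next (n, 0)) (fun _ b => next (n, b + 1)) j
  have mono : ∀ n, StrictMono (e n) := fun n => strictMono_nat_of_lt_succ fun j =>
    (next_spec n (e n j + 1)).1
  refine ⟨e, ?_, fun n => ⟨mono n, Set.Subset.antisymm ?_ ?_⟩⟩
  · exact Computable.nat_rec (f := fun p : ℕ × ℕ => p.2) (g := fun p : ℕ × ℕ => next (p.1, 0))
      (h := fun (p q : ℕ × ℕ) => next (p.1, q.2 + 1)) Computable.snd
      (next_computable.comp (Computable.fst.pair (Computable.const 0)))
      (next_computable.comp ((Computable.fst.comp Computable.fst).pair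
        (Computable.succ.comp (Computable.snd.comp Computable.snd))))
  · rintro _ ⟨j, rfl⟩
    cases j with
    | zero => exact (next_spec n 0).2
    | succ j => exact (next_spec n (e n j + 1)).2
  · intro s hs
    have hex : ∃ j, s ≤ e n j := ⟨s, (mono n).le_apply⟩
    obtain ⟨j, hj, hmin⟩ : ∃ j, s ≤ e n j ∧ ∀ i < j, e n i < s := by
      classical
      exact ⟨Nat.find hex, Nat.find_spec hex, fun i hi => not_le.1 (Nat.find_min hex hi)⟩
    refine ⟨j, le_antisymm ?_ hj⟩
    cases j with
    | zero => exact next_min n 0 s (Nat.zero_le _) hs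
    | succ j => exact next_min n (e n j + 1) s (hmin j (Nat.lt_succ_self j)) hs

open Nat.Partrec (Code) in
/-- Uniformly c.e. infinite sets have uniformly computable enumerations without repetitions. -/
theorem exists_uniformEnumeration {X : ℕ → Set ℕ} (hX : UniformlyCE X)
    (hinf : ∀ n, (X n).Infinite) : ∃ x : ℕ → ℕ → ℕ, UniformEnumeration x X := by
  obtain ⟨c, hc⟩ := Code.exists_code.1 hX
  have mem_iff : ∀ n a, a ∈ X n ↔ ∃ k, (Code.evaln k c (encode (n, a))).isSome := by
    intro n a
    have h1 : a ∈ X n ↔ (c.eval (encode (n, a))).Dom := by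
      rw [hc]
      simp [Part.assert]
    rw [h1, Part.dom_iff_mem]
    simp only [Code.evaln_complete, Option.isSome_iff_exists, Option.mem_def]
    exact exists_comm
  -- Here `s` codes a number and the exact step bound at which it is accepted. Each element has
  -- exactly one such code, so projecting an increasing list of codes gives no repetitions.
  let P : ℕ → ℕ → Prop := fun n s =>
    (Code.evaln (s.unpair.2 + 1) c (encode (n, s.unpair.1))).isSome = true ∧
      (Code.evaln s.unpair.2 c (encode (n, s.unpair.1))).isSome = false
  have isSome_mono : ∀ {k l v}, k ≤ l → (Code.evaln k c v).isSome = true →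
      (Code.evaln l c v).isSome = true := by
    intro k l v hkl h
    obtain ⟨y, hy⟩ := Option.isSome_iff_exists.1 h
    exact Option.isSome_iff_exists.2 ⟨y, Code.evaln_mono hkl hy⟩
  have hP : ComputablePred fun p : ℕ × ℕ => P p.1 p.2 := by
    have harg : Primrec fun p : ℕ × ℕ => encode (p.1, p.2.unpair.1) :=
      Primrec.encode.comp (Primrec.fst.pair (Requirement.primrec_fst_unpair.comp Primrec.snd))
    have hst : Primrec fun p : ℕ × ℕ => p.2.unpair.2 :=
      Requirement.primrec_snd_unpair.comp Primrec.snd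
    refine PrimrecPred.computablePred (PrimrecPred.and ?_ ?_)
    · exact Primrec.eq.comp (Primrec.option_isSome.comp (Requirement.primrec_evaln_comp
        (Primrec.succ.comp hst) (Primrec.const c) harg)) (Primrec.const true)
    · exact Primrec.eq.comp (Primrec.option_isSome.comp (Requirement.primrec_evaln_comp
        hst (Primrec.const c) harg)) (Primrec.const false)
  have hstage : ∀ n, ∀ a ∈ X n, ∃ k, P n (Nat.pair a k) := by
    intro n a ha
    have hex := (mem_iff n a).1 ha
    -- The least bound is a successor because `evaln` with bound `0` never succeeds.
    rcases h : Nat.find hex with - | k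
    · have := Nat.find_spec hex
      rw [h] at this
      simp [Code.evaln] at this
    · refine ⟨k, ?_, ?_⟩
      · have := Nat.find_spec hex
        rw [h] at this
        simpa using this
      · simpa using Nat.find_min hex (m := k) (by omega)
  have hPinf : ∀ n b, ∃ s, b ≤ s ∧ P n s := by
    intro n b
    obtain ⟨a, ha, hb⟩ := (hinf n).exists_gt b
    obtain ⟨k, hk⟩ := hstage n a ha
    exact ⟨_, hb.le.trans (Nat.left_le_pair _ _), hk⟩
  obtain ⟨e, he, hrange⟩ := exists_computable_enumeration hP hPinf
  have heP : ∀ n j, P n (e n j) := fun n j => (hrange n).2.subset ⟨j, rfl⟩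
  refine ⟨fun n j => (e n j).unpair.1, ?_, fun n => ⟨?_, Set.Subset.antisymm ?_ ?_⟩⟩
  · exact Requirement.primrec_fst_unpair.to_comp.comp he
  · intro i j hij
    refine (hrange n).1.injective ?_
    have h1 := heP n i
    have h2 := heP n j
    dsimp only at hij
    simp only [P, hij] at h1 h2
    have hk : (e n i).unpair.2 = (e n j).unpair.2 := by
      rcases lt_trichotomy (e n i).unpair.2 (e n j).unpair.2 with h | h | h
      · have := isSome_mono h h1.1
        rw [h2.2] at this; cases this
      · exact h
      · have := isSome_mono h h2.1
        rw [h1.2] at this; cases this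
    rw [← Nat.pair_unpair (e n i), hij, hk, Nat.pair_unpair]
  · rintro _ ⟨j, rfl⟩
    exact (mem_iff n _).2 ⟨_, (heP n j).1⟩
  · intro a ha
    obtain ⟨k, hk⟩ := hstage n a ha
    obtain ⟨j, hj⟩ := (hrange n).2.superset hk
    exact ⟨j, by simp [hj]⟩

theorem finite_setReducible {X : Set ℕ} (hX : X.Finite) (Y : Set ℕ) : SetReducible X Y := by
  classical
  refine setReducible_iff.2 (Computable.computableIn ?_)
  have h : PrimrecPred fun n : ℕ => n ∈ X :=
    (Requirement.primrecRel_mem.comp (Primrec.const hX.toFinset.toList) Primrec.id).of_eq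
      fun n => by simp
  exact h.decide.to_comp

/-- A finite set is computable, so its degree would lie below that of the next set. -/
theorem infinite_of_incomparable {X : ℕ → Set ℕ}
    (hX : Pairwise fun m n => ¬ deg (X m) ≤ deg (X n)) (n : ℕ) : (X n).Infinite := fun h =>
  hX (Nat.succ_ne_self n).symm ((deg_le_deg_iff _ _).2 (finite_setReducible h _))

/-! ### The order `<_X` -/

theorem exists_deg_eq (d : Degree) : ∃ X, deg X = d := Quot.exists_rep d

section Position

variable (x : ℕ → ℕ)

theorem position_even (n : ℕ) : position x (2 * n) = 2 * n := by simp [position]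

theorem position_odd (n : ℕ) : position x (2 * n + 1) = 2 * x n + 1 := by
  have h1 : (2 * n + 1) % 2 = 1 := by omega
  have h2 : (2 * n + 1) / 2 = n := by omega
  simp [position, h1, h2]

variable {x}

theorem position_injective (hx : Function.Injective x) : Function.Injective (position x) := by
  intro a b hab
  obtain ⟨k, rfl | rfl⟩ := Nat.even_or_odd' a <;> obtain ⟨l, rfl | rfl⟩ := Nat.even_or_odd' b <;>
    simp only [position_even, position_odd] at hab
  · exact hab
  · omega
  · omega
  · rw [hx (show x k = x l by omega)]

open scoped Classical in
/-- An index of `a` in the enumeration `x`. -/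
noncomputable def enumIndex (x : ℕ → ℕ) (a : ℕ) : ℕ :=
  -- The first disjunct ends the search at `0` when `a` is not enumerated, so the search is total.
  Nat.find (p := fun n => a ∉ Set.range x ∨ x n = a) (by
    by_cases h : a ∈ Set.range x
    · obtain ⟨n, hn⟩ := h; exact ⟨n, Or.inr hn⟩
    · exact ⟨0, Or.inl h⟩)

theorem enumIndex_spec {a : ℕ} (h : a ∈ Set.range x) : x (enumIndex x a) = a := by
  classical
  have : a ∉ Set.range x ∨ x (enumIndex x a) = a :=
    Nat.find_spec (p := fun n => a ∉ Set.range x ∨ x n = a) _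
  exact this.resolve_left (not_not.2 h)

open scoped Classical in
/-- The successor function of the order `<_X`. -/
noncomputable def enumSucc (x : ℕ → ℕ) (b : ℕ) : ℕ :=
  bif decide (b % 2 = 0) then
    bif decide (b / 2 ∈ Set.range x) then 2 * enumIndex x (b / 2) + 1 else b + 2
  else 2 * x (b / 2) + 2

/-- All even positions are occupied, and position `2k + 1` is vacant exactly when `k` is not
enumerated; only then is a position skipped. -/
theorem position_enumSucc (b : ℕ) : position x b < position x (enumSucc x b) ∧
    ∀ a, position x b < position x a → position x (enumSucc x b) ≤ position x a := by
  obtain ⟨k, rfl | rfl⟩ := Nat.even_or_odd' b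
  · by_cases hk : k ∈ Set.range x
    · have e : enumSucc x (2 * k) = 2 * enumIndex x k + 1 := by simp [enumSucc, hk]
      rw [e, position_odd, position_even, enumIndex_spec hk]
      exact ⟨by omega, fun a h => by omega⟩
    · have e : enumSucc x (2 * k) = 2 * (k + 1) := by simp [enumSucc, hk]; ring
      rw [e, position_even, position_even]
      refine ⟨by omega, fun a h => ?_⟩
      obtain ⟨l, rfl | rfl⟩ := Nat.even_or_odd' a <;>
        simp only [position_even, position_odd] at h ⊢
      · omega
      · have : x l ≠ k := fun hl => hk ⟨l, hl⟩
        omega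
  · have h1 : (2 * k + 1) % 2 = 1 := by omega
    have h2 : (2 * k + 1) / 2 = k := by omega
    have e : enumSucc x (2 * k + 1) = 2 * (x k + 1) := by simp [enumSucc, h1, h2]; ring
    rw [e, position_even, position_odd]
    exact ⟨by omega, fun a h => by omega⟩

/-- The `k`-th element of `ω` in the order `<_X`. -/
noncomputable def enumNth (x : ℕ → ℕ) (k : ℕ) : ℕ :=
  Nat.rec (motive := fun _ => ℕ) 0 (fun _ b => enumSucc x b) k

theorem position_enumNth_strictMono (x : ℕ → ℕ) : StrictMono fun k => position x (enumNth x k) :=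
  strictMono_nat_of_lt_succ fun _ => (position_enumSucc _).1

/-- The first term whose position reaches that of `b` is `b`, since successors skip no element and
the sequence starts at position `0`. -/
theorem enumNth_bijective (hx : Function.Injective x) : Function.Bijective (enumNth x) := by
  refine ⟨fun i j h => (position_enumNth_strictMono x).injective (congrArg (position x) h), ?_⟩
  intro b
  obtain ⟨j, hj, hmin⟩ : ∃ j, position x b ≤ position x (enumNth x j) ∧
      ∀ i < j, position x (enumNth x i) < position x b := by
    classical
    have hex : ∃ j, position x b ≤ position x (enumNth x j) :=
      ⟨_, (position_enumNth_strictMono x).le_apply⟩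
    exact ⟨Nat.find hex, Nat.find_spec hex, fun i hi => not_le.1 (Nat.find_min hex hi)⟩
  refine ⟨j, position_injective hx (le_antisymm ?_ hj)⟩
  cases j with
  | zero => exact Nat.zero_le _
  | succ j => exact (position_enumSucc _).2 b (hmin j (Nat.lt_succ_self j))

/-- The isomorphism from `(ω, <)` to `(ω, <_X)`. -/
noncomputable def enumEquiv (hx : Function.Injective x) : ℕ ≃ ℕ :=
  Equiv.ofBijective (enumNth x) (enumNth_bijective hx)

theorem ltEnum_enumNth (x : ℕ → ℕ) (a b : ℕ) :
    ltEnum x (enumNth x a) (enumNth x b) ↔ a < b :=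
  (position_enumNth_strictMono x).lt_iff_lt

/-- The decoding step: an isomorphism sends `k + 1` to the immediate successor of `f k`, and the
successor of `2a` reveals whether `a` was enumerated. -/
theorem mem_range_iff_of_equiv {f : ℕ ≃ ℕ}
    (hf : ∀ a b, ltEnum x (f a) (f b) ↔ a < b) (a : ℕ) :
    a ∈ Set.range x ↔ f (f.symm (2 * a) + 1) ≠ 2 * a + 2 := by
  set k := f.symm (2 * a) with hk
  have hfk : f k = 2 * a := f.apply_symm_apply _
  have hlt : position x (2 * a) < position x (f (k + 1)) := by
    have := (hf k (k + 1)).2 (Nat.lt_succ_self k)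
    rwa [ltEnum, hfk] at this
  have hmin : ∀ b, position x (2 * a) < position x b → position x (f (k + 1)) ≤ position x b := by
    intro b hb
    obtain ⟨j, rfl⟩ := f.surjective b
    have h1 : k < j := (hf k j).1 (by rwa [ltEnum, hfk])
    exact not_lt.1 fun h => absurd ((hf j (k + 1)).1 h) (by omega)
  have e : 2 * a + 2 = 2 * (a + 1) := by ring
  rw [position_even] at hlt hmin
  constructor
  · rintro ⟨m, rfl⟩ h
    have := hmin (2 * m + 1) (by rw [position_odd]; omega)
    rw [h, e, position_even, position_odd] at this
    omega
  · intro h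
    have h1 := hmin (2 * (a + 1)) (by rw [position_even]; omega)
    rw [position_even] at h1
    obtain ⟨l, hl | hl⟩ := Nat.even_or_odd' (f (k + 1)) <;> rw [hl] at hlt h1 h <;>
      simp only [position_even, position_odd] at hlt h1
    · omega
    · exact ⟨l, by omega⟩

end Position

/-! ### Isomorphism spectra of the components -/

/-- The map `e` preserves and reflects the relations. -/
def PreservesRelations {L : FirstOrder.Language.{0, 0}} {M N : Type} (A : L.Structure M)
    (B : L.Structure N) (e : M ≃ N) : Prop :=
  ∀ (n : ℕ) (R : L.Relations n) (v : Fin n → M), B.RelMap R (e ∘ v) ↔ A.RelMap R v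

/-- The isomorphism given by a bijection that preserves and reflects the relations. -/
def isoOfEquiv {L : FirstOrder.Language.{0, 0}} [L.IsRelational] {M N : Type} {A : L.Structure M}
    {B : L.Structure N} (e : M ≃ N) (h : PreservesRelations A B e) : Iso A B :=
  { toEquiv := e
    map_fun' := fun g => isEmptyElim g
    map_rel' := fun {n} R v => h n R v }

theorem preservesRelations_iso {L : FirstOrder.Language.{0, 0}} {M N : Type} {A : L.Structure M}
    {B : L.Structure N} (f : Iso A B) : PreservesRelations A B f.toEquiv :=
  fun _ R v => f.map_rel' R v

theorem deg_mem_isoSpec_iff {L : FirstOrder.Language.{0, 0}} [L.IsRelational] {M N : Type}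
    [Primcodable M] [Primcodable N] {A : L.Structure M} {B : L.Structure N} {Y : Set ℕ} :
    deg Y ∈ IsoSpec A B ↔ ∃ e : M ≃ N, PreservesRelations A B e ∧ ComputableIn {chi Y} e :=
  ⟨fun ⟨f, hf⟩ => ⟨f.toEquiv, preservesRelations_iso f, computableFrom_deg_iff.1 hf⟩,
    fun ⟨e, he, hY⟩ => ⟨isoOfEquiv e he, computableFrom_deg_iff.2 hY⟩⟩

theorem preservesRelations_orderStructure {r s : ℕ → ℕ → Prop} {e : ℕ ≃ ℕ} :
    PreservesRelations (orderStructure r) (orderStructure s) e ↔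
      ∀ a b, s (e a) (e b) ↔ r a b := by
  constructor
  · exact fun h a b => h 2 LtSym.lt ![a, b]
  · rintro h _ ⟨⟩ v
    exact h (v 0) (v 1)

/-- The oracle decides whether an element `2k` is followed by an odd number; if so, searching the
enumeration locates it. -/
theorem computableIn_enumNth {O : Set (ℕ →. ℕ)} {x : ℕ → ℕ} (hx : Computable x) {X : Set ℕ}
    (hX : Set.range x = X) (h : open scoped Classical in ComputableIn O fun n => decide (n ∈ X)) :
    ComputableIn O (enumNth x) := by
  classical
  subst hX
  have half : Computable fun b : ℕ => b / 2 :=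
    (Primrec.nat_div.comp Primrec.id (Primrec.const 2)).to_comp
  have hidx : ComputableIn O (enumIndex x) := by
    refine computableIn_find (P := fun a n => a ∉ Set.range x ∨ x n = a) ?_ _
    have h1 : ComputableIn O fun p : ℕ × ℕ => decide (p.1 ∈ Set.range x) :=
      computableIn_comp h ComputableIn.fst
    have h2 : ComputableIn O fun p : ℕ × ℕ => decide (x p.2 = p.1) :=
      Computable.computableIn (Computable₂.comp (f := fun a b : ℕ => decide (a = b))
        Primrec.eq.decide.to_comp (hx.comp Computable.snd) Computable.fst)
    convert computableIn_of_comp₂ (f := fun a b : Bool => !a || b)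
      (Primrec.dom_bool₂ _).to_comp h1 h2 using 2 with p
    by_cases hp : p.1 ∈ Set.range x <;> simp [hp]
  have hsucc : ComputableIn O (enumSucc x) := by
    refine computableIn_cond (Computable.computableIn ?_) (computableIn_cond ?_ ?_ ?_) ?_
    · exact (Primrec.eq.decide.comp (Primrec.nat_mod.comp Primrec.id (Primrec.const 2))
        (Primrec.const 0)).to_comp
    · exact computableIn_comp h half.computableIn
    · exact computableIn_of_comp (f := fun n => 2 * n + 1) Primrec.nat_double_succ.to_comp
        (computableIn_comp hidx half.computableIn)
    · exact (Primrec.nat_add.comp Primrec.id (Primrec.const 2)).to_comp.computableIn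
    · exact Computable.computableIn ((Primrec.nat_add.comp Primrec.nat_double
        (Primrec.const 2)).to_comp.comp (hx.comp half))
  exact computableIn_natRec 0 (h := fun p : ℕ × ℕ => enumSucc x p.2)
    (computableIn_comp hsucc ComputableIn.snd)

section Spectrum

variable {x : ℕ → ℕ → ℕ} {X : ℕ → Set ℕ}

theorem nonempty_iso_copies (hx : UniformEnumeration x X) (n : ℕ) :
    Nonempty (Iso (copiesA n) (copiesB x n)) :=
  ⟨isoOfEquiv (enumEquiv (hx.2 n).1)
    (preservesRelations_orderStructure.2 (ltEnum_enumNth (x n)))⟩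

theorem isoSpec_copies (hx : UniformEnumeration x X) (n : ℕ) :
    IsoSpec (copiesA n) (copiesB x n) = Set.Ici (deg (X n)) := by
  classical
  obtain ⟨hc, hx⟩ := hx
  obtain ⟨hinj, hrange⟩ := hx n
  ext d
  obtain ⟨Y, rfl⟩ := exists_deg_eq d
  rw [Set.mem_Ici, deg_le_deg_iff, deg_mem_isoSpec_iff]
  constructor
  · rintro ⟨f, hrel, hf⟩
    rw [preservesRelations_orderStructure] at hrel
    refine setReducible_iff.2 ?_
    have hsymm : ComputableIn {chi Y} f.symm := computableIn_symm hf
    have h1 : ComputableIn {chi Y} fun a => f (f.symm (2 * a) + 1) :=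
      computableIn_comp hf (computableIn_of_comp Computable.succ
        (computableIn_comp hsymm Primrec.nat_double.computableIn))
    have h2 : Computable₂ fun a b : ℕ => !decide (a = 2 * b + 2) :=
      (Primrec.not.comp (Primrec.eq.decide.comp Primrec.fst (Primrec.nat_add.comp
        (Primrec.nat_double.comp Primrec.snd) (Primrec.const 2)))).to_comp
    convert computableIn_of_comp₂ h2 h1 ComputableIn.id using 2 with a
    rw [← hrange, mem_range_iff_of_equiv hrel]
    simp
  · intro h
    refine ⟨enumEquiv hinj, preservesRelations_orderStructure.2 (ltEnum_enumNth (x n)), ?_⟩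
    exact computableIn_enumNth (hc.comp (Computable.const n) Computable.id) hrange
      (setReducible_iff.1 h)

/-- A generator below `deg (X n)` lies above some `deg (X m)`, and incomparability forces `m = n`.
So distinct `n` need distinct generators. -/
theorem not_finitelyGenerated (hX : Pairwise fun m n => ¬ deg (X m) ≤ deg (X n)) :
    ¬ FinitelyGenerated (⋃ n, Set.Ici (deg (X n))) := by
  rintro ⟨F, hF, hU⟩
  have h1 : ∀ n, ∃ d ∈ F, d ≤ deg (X n) := fun n => by
    have : deg (X n) ∈ ⋃ d ∈ F, Set.Ici d := hU ▸ Set.mem_iUnion.2 ⟨n, Set.self_mem_Ici⟩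
    simpa using this
  choose d hd hle using h1
  have h2 : ∀ n, ∃ m, deg (X m) ≤ d n := fun n => by
    have : d n ∈ ⋃ m, Set.Ici (deg (X m)) :=
      hU ▸ Set.mem_iUnion₂.2 ⟨d n, hd n, Set.self_mem_Ici⟩
    simpa using this
  choose m hm using h2
  have hmn : ∀ n, m n = n := fun n => by
    by_contra h
    exact hX h ((hm n).trans (hle n))
  have hinj : Function.Injective d := fun i j hij => by
    by_contra h
    refine hX h ?_
    have := hm i
    rw [hmn, hij] at this
    exact this.trans (hle j)
  exact Set.infinite_range_of_injective hinj (hF.subset (Set.range_subset_iff.2 hd))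

end Spectrum

/-! ### Computations with finite sets -/

/-- The elements of a finite set, in increasing order. -/
def elements (X : Finset ℕ) : List ℕ :=
  Denumerable.raise' (Denumerable.ofNat (List ℕ) (@encode (Finset ℕ) Primcodable.toEncodable X)) 0

/-- The code of a finite set lists gaps between consecutive elements; `raise'` restores the
elements. -/
theorem coe_elements (X : Finset ℕ) : (elements X : Multiset ℕ) = X.val := by
  have h := congrArg Finset.val (Denumerable.ofNat_encode X)
  rw [← h]
  change (elements X : Multiset ℕ) = Multiset.map (Denumerable.eqv ℕ).symm (elements X : Multiset ℕ)
  have : ((Denumerable.eqv ℕ).symm : ℕ → ℕ) = id := by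
    funext n
    exact Denumerable.ofNat_nat n
  rw [this, Multiset.map_id]

theorem mem_elements {X : Finset ℕ} {n : ℕ} : n ∈ elements X ↔ n ∈ X := by
  rw [← Multiset.mem_coe, coe_elements, Finset.mem_val]

theorem length_elements (X : Finset ℕ) : (elements X).length = X.card := by
  rw [← Multiset.coe_card, coe_elements, Finset.card_val]

theorem primrec_raise' : Primrec fun l : List ℕ => Denumerable.raise' l 0 := by
  -- The recursion changes its offset as it proceeds, so it is rewritten as a left fold carrying the
  -- reversed output and the current offset.
  have h : ∀ (l : List ℕ) (acc : List ℕ) (n : ℕ),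
      (l.foldl (fun (s : List ℕ × ℕ) m => ((m + s.2) :: s.1, m + s.2 + 1)) (acc, n)).1.reverse =
        acc.reverse ++ Denumerable.raise' l n := by
    intro l
    induction l with
    | nil => simp [Denumerable.raise']
    | cons m l ih => intro acc n; simp [Denumerable.raise', ih]
  have hadd : Primrec fun p : List ℕ × (List ℕ × ℕ) × ℕ => p.2.2 + p.2.1.2 :=
    Primrec.nat_add.comp (Primrec.snd.comp Primrec.snd)
      (Primrec.snd.comp (Primrec.fst.comp Primrec.snd))
  have hstep : Primrec₂ fun (_ : List ℕ) (q : (List ℕ × ℕ) × ℕ) =>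
      ((q.2 + q.1.2) :: q.1.1, q.2 + q.1.2 + 1) :=
    (Primrec.list_cons.comp hadd (Primrec.fst.comp (Primrec.fst.comp Primrec.snd))).pair
      (Primrec.succ.comp hadd)
  exact (Primrec.list_reverse.comp (Primrec.fst.comp (Primrec.list_foldl (σ := List ℕ × ℕ)
    Primrec.id (Primrec.const ([], 0)) hstep))).of_eq fun l => by simpa using h l [] 0

theorem primrec_elements : Primrec elements :=
  primrec_raise'.comp ((Primrec.ofNat (List ℕ)).comp Primrec.encode)

/-- Decidable membership in a finite set. -/
def memBool (X : Finset ℕ) (n : ℕ) : Bool := decide (n ∈ X)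

theorem primrec_memBool : Primrec₂ memBool := by
  have h : PrimrecPred fun p : Finset ℕ × ℕ => p.2 ∈ p.1 :=
    (Requirement.primrecRel_mem.comp (primrec_elements.comp Primrec.fst) Primrec.snd).of_eq
      fun p => mem_elements
  exact h.decide

theorem primrecPred_even_card : PrimrecPred fun X : Finset ℕ => Even X.card :=
  (Primrec.eq.comp (Primrec.nat_mod.comp (Primrec.list_length.comp primrec_elements)
    (Primrec.const 2)) (Primrec.const 0)).of_eq fun X => by
      rw [length_elements, Nat.even_iff]

/-- Equality needs testing only at elements of the three sets, which bounds the quantifier. The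
third set is a list to cover both `[i]` and the elements of a candidate code. -/
theorem primrecPred_symmDiff_eq :
    PrimrecPred fun p : Finset ℕ × Finset ℕ × List ℕ => symmDiff p.1 p.2.1 = p.2.2.toFinset := by
  have h : PrimrecRel fun (z : ℕ) (p : Finset ℕ × Finset ℕ × List ℕ) =>
      decide (z ∈ p.2.2) = xor (memBool p.1 z) (memBool p.2.1 z) := by
    refine Primrec.eq.comp ?_ ((Primrec.dom_bool₂ xor).comp ?_ ?_)
    · exact Requirement.primrecRel_mem.decide.comp
        (Primrec.snd.comp (Primrec.snd.comp Primrec.snd)) Primrec.fst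
    · exact primrec_memBool.comp (Primrec.fst.comp Primrec.snd) Primrec.fst
    · exact primrec_memBool.comp (Primrec.fst.comp (Primrec.snd.comp Primrec.snd)) Primrec.fst
  have hL : Primrec fun p : Finset ℕ × Finset ℕ × List ℕ =>
      elements p.1 ++ (elements p.2.1 ++ p.2.2) :=
    Primrec.list_append.comp (primrec_elements.comp Primrec.fst)
      (Primrec.list_append.comp (primrec_elements.comp (Primrec.fst.comp Primrec.snd))
        (Primrec.snd.comp Primrec.snd))
  refine (h.forall_mem_list.comp hL Primrec.id).of_eq fun p => ?_
  obtain ⟨X, Y, l⟩ := p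
  simp only [List.mem_append, mem_elements, id, memBool, Finset.ext_iff, Finset.mem_symmDiff,
    List.mem_toFinset]
  refine forall_congr' fun z => ?_
  by_cases h1 : z ∈ X <;> by_cases h2 : z ∈ Y <;> by_cases h3 : z ∈ l <;> simp [h1, h2, h3]

/-- The code of the result is found by search, using the decidable test above. -/
theorem computable_symmDiff : Computable₂ fun X Y : Finset ℕ => symmDiff X Y := by
  have hex : ∀ p : Finset ℕ × Finset ℕ, ∃ n,
      symmDiff p.1 p.2 = (elements (Denumerable.ofNat (Finset ℕ) n)).toFinset := fun p =>
    ⟨@encode (Finset ℕ) Primcodable.toEncodable (symmDiff p.1 p.2), by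
      ext z
      rw [List.mem_toFinset, mem_elements]
      exact (congrArg (z ∈ ·) (Denumerable.ofNat_encode (symmDiff p.1 p.2))).symm.to_iff⟩
  have hP : PrimrecPred fun q : (Finset ℕ × Finset ℕ) × ℕ =>
      symmDiff q.1.1 q.1.2 = (elements (Denumerable.ofNat (Finset ℕ) q.2)).toFinset :=
    primrecPred_symmDiff_eq.comp (f := fun q : (Finset ℕ × Finset ℕ) × ℕ =>
      (q.1.1, q.1.2, elements (Denumerable.ofNat (Finset ℕ) q.2)))
      ((Primrec.fst.comp Primrec.fst).pair ((Primrec.snd.comp Primrec.fst).pair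
        (primrec_elements.comp ((Primrec.ofNat (Finset ℕ)).comp Primrec.snd))))
  refine ((Computable.ofNat (Finset ℕ)).comp (Computable.find (P := fun p n =>
    symmDiff p.1 p.2 = (elements (Denumerable.ofNat (Finset ℕ) n)).toFinset)
    hP.computablePred hex)).of_eq fun p => ?_
  refine (Finset.ext fun z => ?_ : _ = symmDiff p.1 p.2)
  have := Finset.ext_iff.1 (Nat.find_spec (hex p)) z
  rw [List.mem_toFinset, mem_elements] at this
  exact this.symm

/-! ### The automorphisms of the hypercube -/

/-- The index of the pair of components attached to an element of the hypercube structure. -/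
def slot : Hyp → ℕ := Sum.elim (fun _ => 0) fun p => p.1 + 1

/-- Whether the component of `M` at an element is one of the structures `B n`. -/
def signM : Hyp → Bool := Sum.elim (fun X => !decide (Even X.card)) fun p => p.2

/-- Whether the component of `N` at an element is one of the structures `B n`. -/
def signN : Hyp → Bool := Sum.elim (fun X => decide (Even X.card)) fun p => p.2

theorem symmDiff_right_involutive (S : Finset ℕ) :
    Function.Involutive fun X : Finset ℕ => symmDiff X S := fun X => symmDiff_symmDiff_cancel_right S X

/-- The automorphism of the hypercube structure that translates by `S`. -/
def translate (S : Finset ℕ) : Hyp ≃ Hyp :=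
  Equiv.sumCongr (symmDiff_right_involutive S).toPerm
    (Function.Involutive.toPerm (fun p : ℕ × Bool => (p.1, xor p.2 (memBool S p.1)))
      fun p => by simp)

/-- The set of coordinates to be changed in order to exchange the components at the slot `n`. -/
def slotSet (n : ℕ) : Finset ℕ := if n = 0 then ∅ else {n - 1}

theorem slot_translate (S : Finset ℕ) (z : Hyp) : slot (translate S z) = slot z := by
  rcases z with X | p <;> rfl

theorem even_card_symmDiff_singleton (X : Finset ℕ) (i : ℕ) :
    Even (symmDiff X {i}).card ↔ ¬ Even X.card := by
  by_cases h : i ∈ X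
  · have e : symmDiff X {i} = X.erase i := by
      ext z; simp only [Finset.mem_symmDiff, Finset.mem_singleton, Finset.mem_erase]
      by_cases hz : z = i <;> simp [hz, h]
    rw [e, ← Finset.card_erase_add_one h, Nat.even_add_one, not_not]
  · have e : symmDiff X {i} = insert i X := by
      ext z; simp only [Finset.mem_symmDiff, Finset.mem_singleton, Finset.mem_insert]
      by_cases hz : z = i <;> simp [hz, h]
    rw [e, Finset.card_insert_of_notMem h, Nat.even_add_one]

/-- For `n = 0` nothing moves, and the opposite parity conventions of `M` and `N` differ exactly at
the finite sets. For `n = i + 1`, translation by `{i}` flips parity and cancels that difference,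
while exchanging `(i, 0)` and `(i, 1)`. -/
theorem signN_translate_slotSet (n : ℕ) (z : Hyp) :
    signN (translate (slotSet n) z) = if slot z = n then !signM z else signM z := by
  cases n with
  | zero =>
    rcases z with X | p
    · have : symmDiff X ∅ = X := symmDiff_bot X
      simp [slotSet, slot, signN, signM, translate, this]
    · simp [slotSet, slot, signN, signM, translate, memBool]
  | succ n =>
    rcases z with X | p
    · simp [slotSet, slot, signN, signM, translate, even_card_symmDiff_singleton, -Nat.not_even_iff_odd]
    · by_cases h : p.1 = n <;> simp [slotSet, slot, signN, signM, translate, memBool, h]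

theorem computable_slot : Computable slot :=
  (Primrec.sumCasesOn (f := fun z : Hyp => z) (g := fun _ _ => 0) (h := fun _ p => p.1 + 1)
    Primrec.id (Primrec.const 0) (Primrec.succ.comp (Primrec.fst.comp Primrec.snd))).to_comp.of_eq
    fun z => by cases z <;> rfl

theorem computable_signM : Computable signM :=
  (Primrec.sumCasesOn (f := fun z : Hyp => z) (g := fun _ X => !decide (Even X.card))
    (h := fun _ p => p.2) Primrec.id
    (Primrec.not.comp (primrecPred_even_card.decide.comp Primrec.snd))
    (Primrec.snd.comp Primrec.snd)).to_comp.of_eq fun z => by cases z <;> rfl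

theorem computable_signN : Computable signN :=
  (Primrec.sumCasesOn (f := fun z : Hyp => z) (g := fun _ X => decide (Even X.card))
    (h := fun _ p => p.2) Primrec.id
    (primrecPred_even_card.decide.comp Primrec.snd)
    (Primrec.snd.comp Primrec.snd)).to_comp.of_eq fun z => by cases z <;> rfl

theorem computable_translate (S : Finset ℕ) : Computable (translate S) := by
  refine (Computable.sumCasesOn (f := fun z : Hyp => z)
    (g := fun _ X => (Sum.inl (symmDiff X S) : Hyp))
    (h := fun _ p => (Sum.inr (p.1, xor p.2 (memBool S p.1)) : Hyp)) Computable.id ?_ ?_).of_eq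
    fun z => by cases z <;> rfl
  · exact Computable.sumInl.comp (computable_symmDiff.comp Computable.snd (Computable.const S))
  · exact Computable.sumInr.comp ((Primrec.fst.comp Primrec.snd).pair
      ((Primrec.dom_bool₂ xor).comp (Primrec.snd.comp Primrec.snd)
        (primrec_memBool.comp (Primrec.const S) (Primrec.fst.comp Primrec.snd)))).to_comp

/-! ### Compositions of the hypercube structure with orders -/

/-- The universe of the structures `M` and `N`. -/
abbrev CompUniv : Type := Hyp ⊕ Hyp × ℕ

/-- The element of the hypercube structure below an element of a composition. -/
def base : CompUniv → Hyp := Sum.elim id Prod.fst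

/-- The number of an element in its component. -/
def number : CompUniv → ℕ := Sum.elim (fun _ => 0) Prod.snd

theorem primrec_base : Primrec base :=
  (Primrec.sumCasesOn (f := fun u : CompUniv => u) (g := fun _ z => z) (h := fun _ p => p.1)
    Primrec.id Primrec.snd (Primrec.fst.comp Primrec.snd)).of_eq fun u => by cases u <;> rfl

theorem primrec_number : Primrec number :=
  (Primrec.sumCasesOn (f := fun u : CompUniv => u) (g := fun _ _ => 0) (h := fun _ p => p.2)
    Primrec.id (Primrec.const 0) (Primrec.snd.comp Primrec.snd)).of_eq fun u => by cases u <;> rfl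

theorem primrec_isLeft {α β : Type} [Primcodable α] [Primcodable β] :
    Primrec (Sum.isLeft : α ⊕ β → Bool) :=
  (Primrec.sumCasesOn (f := fun z : α ⊕ β => z) (g := fun _ _ => true) (h := fun _ _ => false)
    Primrec.id (Primrec.const true) (Primrec.const false)).of_eq fun z => by cases z <;> rfl

/-- The order on the component at `z`, one of `<` and `<_X`, according to the sign of `z`. -/
def componentOrder (x : ℕ → ℕ → ℕ) (s : Hyp → Bool) (z : Hyp) (a b : ℕ) : Prop :=
  if s z = true then ltEnum (x (slot z)) a b else a < b

/-- The composition of the hypercube structure with orders on `ω`. -/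
@[reducible] def orderComposition (r : Hyp → ℕ → ℕ → Prop) :
    (compLang hypLang ltLang).Structure CompUniv :=
  composition hypStructure fun z => orderStructure (r z)

theorem orderStructure_componentOrder (x : ℕ → ℕ → ℕ) (s : Hyp → Bool) (z : Hyp) :
    orderStructure (componentOrder x s z) =
      if s z = true then copiesB x (slot z) else copiesA (slot z) := by
  unfold componentOrder
  split_ifs <;> rfl

/-- Slot and sign describe the components of `M` and `N` uniformly, so later arguments treat both at
once. -/
theorem structureM_eq (x : ℕ → ℕ → ℕ) :
    structureM copiesA (copiesB x) = orderComposition (componentOrder x signM) := by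
  unfold structureM orderComposition
  congr 1
  funext z
  rw [orderStructure_componentOrder]
  rcases z with X | ⟨i, _ | _⟩
  · by_cases h : Even X.card <;> simp [componentM, signM, slot, h]
  · rfl
  · rfl

theorem structureN_eq (x : ℕ → ℕ → ℕ) :
    structureN copiesA (copiesB x) = orderComposition (componentOrder x signN) := by
  unfold structureN orderComposition
  congr 1
  funext z
  rw [orderStructure_componentOrder]
  rcases z with X | ⟨i, _ | _⟩
  · by_cases h : Even X.card <;> simp [componentN, signN, slot, h]
  · rfl
  · rfl

/-- The relation `μ`. -/
def RelMu (u v : CompUniv) : Prop :=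
  ∃ z : Hyp, v = Sum.inl z ∧ (u = Sum.inl z ∨ ∃ a : ℕ, u = Sum.inr (z, a))

/-- The relation `D i`. -/
def RelD (i : ℕ) (u v : CompUniv) : Prop :=
  ∃ X : Finset ℕ, u = Sum.inl (Sum.inl X) ∧ v = Sum.inl (Sum.inr (i, decide (i ∈ X)))

/-- The relation `E i`. -/
def RelE (i : ℕ) (u v : CompUniv) : Prop :=
  ∃ X Y : Finset ℕ, u = Sum.inl (Sum.inl X) ∧ v = Sum.inl (Sum.inl Y) ∧ symmDiff X Y = {i}

/-- The relation `<`. -/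
def RelLt (r : Hyp → ℕ → ℕ → Prop) (u v : CompUniv) : Prop :=
  ∃ z a b, u = Sum.inr (z, a) ∧ v = Sum.inr (z, b) ∧ r z a b

/-- The symbol `μ` of the language of compositions. -/
def symMu : (compLang hypLang ltLang).Relations 2 := Sum.inl MuSym.mu

/-- The symbol `D i` of the language of compositions. -/
def symD (i : ℕ) : (compLang hypLang ltLang).Relations 2 := Sum.inr (Sum.inl (HypSym.D i))

/-- The symbol `E i` of the language of compositions. -/
def symE (i : ℕ) : (compLang hypLang ltLang).Relations 2 := Sum.inr (Sum.inl (HypSym.E i))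

/-- The symbol `<` of the language of compositions. -/
def symLt : (compLang hypLang ltLang).Relations 2 := Sum.inr (Sum.inr LtSym.lt)

section RelMap

variable (r : Hyp → ℕ → ℕ → Prop) (v : Fin 2 → CompUniv)

theorem relMap_mu : (orderComposition r).RelMap symMu v ↔ RelMu (v 0) (v 1) := Iff.rfl

theorem eq_fin_two_iff {α β : Type} {v : Fin 2 → α} {g : β → α} {s : Fin 2 → β} :
    (v = fun i => g (s i)) ↔ v 0 = g (s 0) ∧ v 1 = g (s 1) := by
  rw [funext_iff, Fin.forall_fin_two]

theorem relMap_D (i : ℕ) : (orderComposition r).RelMap (symD i) v ↔ RelD i (v 0) (v 1) := by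
  constructor
  · rintro ⟨s, hs, X, h0, h1⟩
    rw [eq_fin_two_iff] at hs
    exact ⟨X, hs.1.trans (congrArg _ h0), hs.2.trans (congrArg _ h1)⟩
  · rintro ⟨X, h0, h1⟩
    exact ⟨![_, _], eq_fin_two_iff.2 ⟨h0, h1⟩, X, rfl, rfl⟩

theorem relMap_E (i : ℕ) : (orderComposition r).RelMap (symE i) v ↔ RelE i (v 0) (v 1) := by
  constructor
  · rintro ⟨s, hs, X, Y, h0, h1, h⟩
    rw [eq_fin_two_iff] at hs
    exact ⟨X, Y, hs.1.trans (congrArg _ h0), hs.2.trans (congrArg _ h1), h⟩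
  · rintro ⟨X, Y, h0, h1, h⟩
    exact ⟨![_, _], eq_fin_two_iff.2 ⟨h0, h1⟩, X, Y, rfl, rfl, h⟩

theorem relMap_lt : (orderComposition r).RelMap symLt v ↔ RelLt r (v 0) (v 1) := by
  constructor
  · rintro ⟨z, a, hs, h⟩
    rw [eq_fin_two_iff (g := fun a => Sum.inr (z, a))] at hs
    exact ⟨z, a 0, a 1, hs.1, hs.2, h⟩
  · rintro ⟨z, a, b, h0, h1, h⟩
    exact ⟨z, ![a, b], (eq_fin_two_iff (g := fun a => Sum.inr (z, a))).2 ⟨h0, h1⟩, h⟩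

end RelMap

theorem preservesRelations_orderComposition {r r' : Hyp → ℕ → ℕ → Prop} {e : CompUniv ≃ CompUniv} :
    PreservesRelations (orderComposition r) (orderComposition r') e ↔
      ∀ u v, (RelMu (e u) (e v) ↔ RelMu u v) ∧ (∀ i, RelD i (e u) (e v) ↔ RelD i u v) ∧
        (∀ i, RelE i (e u) (e v) ↔ RelE i u v) ∧ (RelLt r' (e u) (e v) ↔ RelLt r u v) := by
  constructor
  · intro h u v
    refine ⟨?_, fun i => ?_, fun i => ?_, ?_⟩
    · simpa [relMap_mu] using h 2 symMu ![u, v]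
    · simpa [relMap_D] using h 2 (symD i) ![u, v]
    · simpa [relMap_E] using h 2 (symE i) ![u, v]
    · simpa [relMap_lt] using h 2 symLt ![u, v]
  · intro h n R v
    rcases R with R | R | R <;> cases R
    · exact (h (v 0) (v 1)).1
    · exact (relMap_D _ _ _).trans (((h (v 0) (v 1)).2.1 _).trans (relMap_D _ _ _).symm)
    · exact (relMap_E _ _ _).trans (((h (v 0) (v 1)).2.2.1 _).trans (relMap_E _ _ _).symm)
    · exact (relMap_lt _ _).trans ((h (v 0) (v 1)).2.2.2.trans (relMap_lt _ _).symm)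

/-! ### Isomorphisms of compositions -/

theorem relMu_inl_self (z : Hyp) : RelMu (Sum.inl z) (Sum.inl z) := ⟨z, rfl, Or.inl rfl⟩

/-- Isomorphisms of compositions respect the components. -/
theorem exists_components {r r' : Hyp → ℕ → ℕ → Prop} {e : CompUniv ≃ CompUniv}
    (he : PreservesRelations (orderComposition r) (orderComposition r') e) :
    ∃ φ : Hyp → Hyp, (∀ z, e (Sum.inl z) = Sum.inl (φ z)) ∧
      ∀ z, ∃ g : ℕ ≃ ℕ, (∀ k, e (Sum.inr (z, k)) = Sum.inr (φ z, g k)) ∧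
        ∀ a b, r' (φ z) (g a) (g b) ↔ r z a b := by
  rw [preservesRelations_orderComposition] at he
  -- The elements of `H` are exactly those that are `μ`-related to themselves.
  have top : ∀ z, ∃ w, e (Sum.inl z) = Sum.inl w := fun z => by
    obtain ⟨w, hw, -⟩ := (he (Sum.inl z) (Sum.inl z)).1.2 (relMu_inl_self z)
    exact ⟨w, hw⟩
  choose φ hφ using top
  have top_symm : ∀ w, ∃ z, e.symm (Sum.inl w) = Sum.inl z := fun w => by
    have := (he (e.symm (Sum.inl w)) (e.symm (Sum.inl w))).1.1
      (by rw [e.apply_symm_apply]; exact relMu_inl_self w)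
    obtain ⟨z, hz, -⟩ := this
    exact ⟨z, hz⟩
  have hφinj : Function.Injective φ := fun z w h => by
    have := e.injective ((hφ z).trans ((congrArg Sum.inl h).trans (hφ w).symm))
    exact Sum.inl_injective this
  -- The relation `μ` sends `(z, k)` either to `φ z` itself or into its component; the former is
  -- impossible because `e.symm` also preserves `H`.
  have bottom : ∀ z k, ∃ j, e (Sum.inr (z, k)) = Sum.inr (φ z, j) := by
    intro z k
    obtain ⟨w, hw, h | ⟨a, h⟩⟩ :=
      (he (Sum.inr (z, k)) (Sum.inl z)).1.2 ⟨z, rfl, Or.inr ⟨k, rfl⟩⟩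
    · obtain ⟨y, hy⟩ := top_symm w
      rw [← h, e.symm_apply_apply] at hy
      cases hy
    · obtain rfl : φ z = w := Sum.inl_injective ((hφ z).symm.trans hw)
      exact ⟨a, h⟩
  choose g hg using bottom
  refine ⟨φ, hφ, fun z => ?_⟩
  have hbij : Function.Bijective (g z) := by
    constructor
    · intro a b h
      have := e.injective ((hg z a).trans ((by rw [h] : _ = _).trans (hg z b).symm))
      simpa using this
    · intro b
      rcases h : e.symm (Sum.inr (φ z, b)) with y | ⟨y, k⟩
      · have := (Equiv.symm_apply_eq e).1 h
        rw [hφ] at this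
        cases this
      · have := (Equiv.symm_apply_eq e).1 h
        rw [hg] at this
        have h2 := Sum.inr_injective this
        simp only [Prod.mk.injEq] at h2
        obtain rfl := hφinj h2.1
        exact ⟨k, h2.2.symm⟩
  refine ⟨Equiv.ofBijective (g z) hbij, hg z, fun a b => ?_⟩
  have h := (he (Sum.inr (z, a)) (Sum.inr (z, b))).2.2.2
  rw [hg, hg] at h
  have aux : ∀ (s : Hyp → ℕ → ℕ → Prop) w c d,
      RelLt s (Sum.inr (w, c)) (Sum.inr (w, d)) ↔ s w c d := by
    intro s w c d
    simp [RelLt]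
  rwa [aux, aux] at h

/-- The bijection of the universe of a composition with given parts. -/
def compEquiv (φ : Hyp ≃ Hyp) (g : Hyp → ℕ ≃ ℕ) : CompUniv ≃ CompUniv :=
  Equiv.sumCongr φ (Equiv.prodShear φ g)

/-- Translation adds characteristic functions modulo 2, which matches the change of `a` in `(i, a)`
and preserves `D_i`; it leaves symmetric differences alone, which preserves `E_i`. -/
theorem preservesRelations_compEquiv {r r' : Hyp → ℕ → ℕ → Prop} {S : Finset ℕ}
    {g : Hyp → ℕ ≃ ℕ} (hg : ∀ z a b, r' (translate S z) (g z a) (g z b) ↔ r z a b) :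
    PreservesRelations (orderComposition r) (orderComposition r') (compEquiv (translate S) g) := by
  have hl : ∀ z, compEquiv (translate S) g (Sum.inl z) = Sum.inl (translate S z) := fun _ => rfl
  have hr : ∀ z k, compEquiv (translate S) g (Sum.inr (z, k)) =
    Sum.inr (translate S z, g z k) := fun _ _ => rfl
  have hX : ∀ X, translate S (Sum.inl X) = Sum.inl (symmDiff X S) := fun _ => rfl
  have hp : ∀ i a, translate S (Sum.inr (i, a)) = Sum.inr (i, xor a (memBool S i)) :=
    fun _ _ => rfl
  rw [preservesRelations_orderComposition]
  intro u v
  refine ⟨?_, fun i => ?_, fun i => ?_, ?_⟩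
  · rcases u with z | ⟨z, a⟩ <;> rcases v with w | ⟨w, b⟩ <;> simp [RelMu, hl, hr]
  · rcases u with (X | ⟨j, a⟩) | ⟨z, a⟩ <;> rcases v with (Y | ⟨l, b⟩) | ⟨w, b⟩ <;>
      simp only [RelD, hl, hr, hX, hp, Sum.inl.injEq, reduceCtorEq, false_and, and_false,
        exists_false, exists_eq_left', Sum.inr.injEq, Prod.mk.injEq]
    refine and_congr_right ?_
    rintro rfl
    by_cases h1 : l ∈ X <;> by_cases h2 : l ∈ S <;> cases b <;>
      simp [Finset.mem_symmDiff, memBool, h1, h2]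
  · rcases u with (X | ⟨j, a⟩) | ⟨z, a⟩ <;> rcases v with (Y | ⟨l, b⟩) | ⟨w, b⟩ <;>
      simp only [RelE, hl, hr, hX, hp, Sum.inl.injEq, reduceCtorEq, false_and, and_false,
        exists_false]
    have hXY : symmDiff (symmDiff X S) (symmDiff Y S) = symmDiff X Y := by
      rw [symmDiff_comm Y S, ← symmDiff_assoc, symmDiff_symmDiff_cancel_right]
    simp [hXY]
  · rcases u with z | ⟨z, a⟩ <;> rcases v with w | ⟨w, b⟩ <;> simp [RelLt, hl, hr]
    rintro rfl
    exact hg w a b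

section Spectrum

variable {x : ℕ → ℕ → ℕ}

/-- The isomorphism from `M` to `N` obtained from an isomorphism of the components at slot `n`. -/
def slotEquiv (n : ℕ) (f : ℕ ≃ ℕ) : CompUniv ≃ CompUniv :=
  compEquiv (translate (slotSet n)) fun z =>
    if slot z = n then (if signM z = true then f.symm else f) else Equiv.refl ℕ

/-- At slot `n` the orders are exchanged, by `f` in one direction and its inverse in the other;
elsewhere corresponding components carry the same order. -/
theorem preservesRelations_slotEquiv {n : ℕ} {f : ℕ ≃ ℕ}
    (hf : ∀ a b, ltEnum (x n) (f a) (f b) ↔ a < b) :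
    PreservesRelations (orderComposition (componentOrder x signM))
      (orderComposition (componentOrder x signN)) (slotEquiv n f) := by
  refine preservesRelations_compEquiv fun z a b => ?_
  unfold componentOrder
  rw [signN_translate_slotSet, slot_translate]
  by_cases h1 : slot z = n
  · cases h2 : signM z
    · simp [h1, hf]
    · have := hf (f.symm a) (f.symm b)
      simp only [f.apply_symm_apply] at this
      simp [h1, this]
  · simp [h1]

theorem computableIn_slotEquiv {O : Set (ℕ →. ℕ)} (n : ℕ) {f : ℕ ≃ ℕ} (hf : ComputableIn O f) :
    ComputableIn O (slotEquiv n f) := by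
  have hbase : Computable base := primrec_base.to_comp
  have hnum : ComputableIn O number := primrec_number.computableIn
  have hφ := (computable_translate (slotSet n)).comp hbase
  have hslot : Computable fun u : CompUniv => decide (slot (base u) = n) :=
    Computable₂.comp (f := fun a b : ℕ => decide (a = b)) Primrec.eq.decide.to_comp
      (computable_slot.comp hbase) (Computable.const n)
  have hsymm := computableIn_symm hf
  have hval := computableIn_cond hslot.computableIn
    (computableIn_cond (computable_signM.comp hbase).computableIn
      (computableIn_comp hsymm hnum) (computableIn_comp hf hnum))
    hnum
  have key := computableIn_cond primrec_isLeft.computableIn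
    (Computable.computableIn (Computable.sumInl.comp hφ))
    (computableIn_of_comp (Computable.sumInr (α := Hyp) (β := Hyp × ℕ))
      (computableIn_pair hφ.computableIn hval))
  convert key using 2 with u
  rcases u with z | ⟨z, k⟩
  · rfl
  · change Sum.inr (_, _) = Sum.inr (_, _)
    simp only [base, number, Sum.elim_inr]
    by_cases h1 : slot z = n <;> cases signM z <;> simp [h1]

theorem isoSpec_structures (x : ℕ → ℕ → ℕ) :
    IsoSpec (structureM copiesA (copiesB x)) (structureN copiesA (copiesB x)) =
      ⋃ n, IsoSpec (copiesA n) (copiesB x n) := by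
  rw [structureM_eq, structureN_eq]
  ext d
  obtain ⟨Y, rfl⟩ := exists_deg_eq d
  simp only [Set.mem_iUnion, deg_mem_isoSpec_iff]
  constructor
  · rintro ⟨e, he, hY⟩
    obtain ⟨φ, hφ, hcomp⟩ := exists_components he
    -- It suffices to find one component where `e` carries `A n` to `B n`; its restriction there is
    -- computable from `e`.
    have key : ∀ z, signM z = false → signN (φ z) = true → slot (φ z) = slot z →
        ∃ n, ∃ e : ℕ ≃ ℕ, PreservesRelations (copiesA n) (copiesB x n) e ∧
          ComputableIn {chi Y} e := by
      intro z h1 h2 h3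
      obtain ⟨g, hg, hr⟩ := hcomp z
      refine ⟨slot z, g, preservesRelations_orderStructure.2 fun a b => ?_, ?_⟩
      · simpa [componentOrder, h1, h2, h3] using hr a b
      · have hin : Computable fun k : ℕ => (Sum.inr (z, k) : CompUniv) :=
          Computable.sumInr.comp ((Computable.const z).pair Computable.id)
        convert computableIn_of_comp primrec_number.to_comp (computableIn_comp hY hin.computableIn) using 2 with k
        rw [hg]
        rfl
    rw [preservesRelations_orderComposition] at he
    have hD : ∀ i, RelD i (Sum.inl (φ (Sum.inl ∅))) (Sum.inl (φ (Sum.inr (i, false)))) := by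
      intro i
      rw [← hφ, ← hφ]
      exact ((he _ _).2.1 i).2 ⟨∅, rfl, by simp⟩
    -- The index `0` is arbitrary: this only shows that `φ` sends `∅` to a finite set.
    obtain ⟨X, hX, -⟩ := hD 0
    have hX := Sum.inl_injective hX
    rcases X.eq_empty_or_nonempty with rfl | ⟨i, hi⟩
    · exact key (Sum.inl ∅) (by simp [signM]) (by rw [hX]; simp [signN]) (by rw [hX])
    · obtain ⟨X', hX', h⟩ := hD i
      obtain rfl : X = X' := Sum.inl_injective (hX.symm.trans (Sum.inl_injective hX'))
      have h := Sum.inl_injective h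
      exact key (Sum.inr (i, false)) rfl (by rw [h]; simp [signN, hi]) (by rw [h]; rfl)
  · rintro ⟨n, f, hf, hY⟩
    exact ⟨slotEquiv n f,
      preservesRelations_slotEquiv (preservesRelations_orderStructure.1 hf),
      computableIn_slotEquiv n hY⟩

theorem nonempty_iso_structures {X : ℕ → Set ℕ} (hx : UniformEnumeration x X) :
    Nonempty (Iso (structureM copiesA (copiesB x)) (structureN copiesA (copiesB x))) := by
  rw [structureM_eq, structureN_eq]
  exact ⟨isoOfEquiv (slotEquiv 0 (enumEquiv (hx.2 0).1))
    (preservesRelations_slotEquiv (ltEnum_enumNth (x 0)))⟩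

end Spectrum

/-! ### Computability of the structures -/

/-- A computable function deciding the relations makes a family of structures in a language with
binary symbols uniformly computable. -/
theorem uniformlyComputable_of_binary {L : FirstOrder.Language.{0, 0}} [L.IsRelational]
    [Primcodable (Σ n, L.Relations n)] {I M : Type} [Primcodable I] [Primcodable M] [Inhabited M]
    {A : I → L.Structure M} (hL : ∀ R : Σ n, L.Relations n, R.1 = 2)
    {T : I → (Σ n, L.Relations n) → M × M → Bool}
    (hT : Computable fun q : (I × Σ n, L.Relations n) × M × M => T q.1.1 q.1.2 q.2)
    (h : ∀ i (R : L.Relations 2) (v : Fin 2 → M),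
      (A i).RelMap R v ↔ T i ⟨2, R⟩ (v 0, v 1) = true) :
    UniformlyComputable A := by
  refine ⟨(Computable.const 2).of_eq fun R => (hL R).symm, ?_⟩
  have hlist : Computable fun q : I × (Σ n, L.Relations n) × List M => q.2.2 :=
    Computable.snd.comp Computable.snd
  -- The default value never matters: lists of length other than two are rejected by `hlen`.
  have hget : ∀ k, Computable fun q : I × (Σ n, L.Relations n) × List M =>
      q.2.2[k]?.getD default := fun k =>
    Computable.option_getD (Computable.list_getElem?.comp hlist (Computable.const k))
      (Computable.const default)
  have hlen : Computable fun q : I × (Σ n, L.Relations n) × List M =>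
      decide (q.2.2.length = 2) :=
    Computable₂.comp (f := fun a b : ℕ => decide (a = b)) Primrec.eq.decide.to_comp
      (Computable.list_length.comp hlist) (Computable.const 2)
  have hall := Computable₂.comp (f := fun a b : Bool => a && b) Primrec.and.to_comp hlen
    (hT.comp ((Computable.fst.pair (Computable.fst.comp Computable.snd)).pair
      ((hget 0).pair (hget 1))))
  refine ComputablePred.computable_iff.2 ⟨_, hall, funext fun q => propext ?_⟩
  obtain ⟨i, ⟨n, R⟩, l⟩ := q
  obtain rfl : n = 2 := hL ⟨n, R⟩
  simp only [AtomicDiagram, Bool.and_eq_true, decide_eq_true_eq]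
  constructor
  · rintro ⟨v, rfl, hv⟩
    exact ⟨by simp, by simpa using (h i R v).1 hv⟩
  · rintro ⟨hl, ht⟩
    obtain ⟨u, w, rfl⟩ := List.length_eq_two.1 hl
    exact ⟨![u, w], by simp, (h i R _).2 (by simpa using ht)⟩

theorem UniformlyComputable.computableStructure {L : FirstOrder.Language.{0, 0}} [L.IsRelational]
    [Primcodable (Σ n, L.Relations n)] {I M : Type} [Primcodable I] [Primcodable M]
    {A : I → L.Structure M} (h : UniformlyComputable A) (i : I) : ComputableStructure (A i) := by
  classical
  exact ⟨h.1, Computable.computablePred (h.2.decide.comp ((Computable.const i).pair Computable.id))⟩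

theorem computable_decide_lt : Computable₂ fun a b : ℕ => decide (a < b) :=
  Primrec.nat_lt.decide.to_comp

theorem uniformlyComputable_copiesA : UniformlyComputable copiesA := by
  refine uniformlyComputable_of_binary (T := fun _ _ p => decide (p.1 < p.2)) ?_ ?_ ?_
  · rintro ⟨_, ⟨⟩⟩; rfl
  · exact computable_decide_lt.comp (Computable.fst.comp Computable.snd)
      (Computable.snd.comp Computable.snd)
  · rintro i ⟨⟩ v
    exact (decide_eq_true_iff (p := v 0 < v 1)).symm

instance (x : ℕ → ℕ) (a b : ℕ) : Decidable (ltEnum x a b) := by unfold ltEnum; infer_instance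

theorem computable_position {x : ℕ → ℕ → ℕ} (hx : Computable₂ x) :
    Computable₂ fun n a : ℕ => position (x n) a := by
  have h1 : Computable fun p : ℕ × ℕ => decide (p.2 % 2 = 0) :=
    (Primrec.eq.decide.comp (Primrec.nat_mod.comp Primrec.snd (Primrec.const 2))
      (Primrec.const 0)).to_comp
  have h2 : Computable fun p : ℕ × ℕ => 2 * x p.1 (p.2 / 2) + 1 :=
    Primrec.nat_double_succ.to_comp.comp (hx.comp Computable.fst
      (Primrec.nat_div.comp Primrec.snd (Primrec.const 2)).to_comp)
  refine (Computable.cond h1 Computable.snd h2).of_eq fun p => ?_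
  simp [position, Bool.cond_decide]

theorem computable_decide_ltEnum {x : ℕ → ℕ → ℕ} (hx : Computable₂ x) {α : Type} [Primcodable α]
    {n a b : α → ℕ} (hn : Computable n) (ha : Computable a) (hb : Computable b) :
    Computable fun q => decide (ltEnum (x (n q)) (a q) (b q)) :=
  computable_decide_lt.comp ((computable_position hx).comp hn ha)
    ((computable_position hx).comp hn hb)

theorem uniformlyComputable_copiesB {x : ℕ → ℕ → ℕ} (hx : Computable₂ x) :
    UniformlyComputable (copiesB x) := by
  refine uniformlyComputable_of_binary (T := fun i _ p => decide (ltEnum (x i) p.1 p.2)) ?_ ?_ ?_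
  · rintro ⟨_, ⟨⟩⟩; rfl
  · exact computable_decide_ltEnum hx (Computable.fst.comp Computable.fst)
      (Computable.fst.comp Computable.snd) (Computable.snd.comp Computable.snd)
  · rintro i ⟨⟩ v
    exact (decide_eq_true_iff (p := ltEnum (x i) (v 0) (v 1))).symm

/-! ### Computability of compositions -/

/-- The finite set that an element of the hypercube structure is. -/
def finset : Hyp → Finset ℕ := Sum.elim id fun _ => ∅

theorem primrec_finset : Primrec finset :=
  (Primrec.sumCasesOn (f := fun z : Hyp => z) (g := fun _ X => X) (h := fun _ _ => ∅)
    Primrec.id Primrec.snd (Primrec.const ∅)).of_eq fun z => by cases z <;> rfl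

/-- The code of a symbol of the language of compositions. -/
def symbolCode (R : Σ n, (compLang hypLang ltLang).Relations n) : Unit ⊕ (ℕ ⊕ ℕ) ⊕ Unit :=
  match R with
  | ⟨_, Sum.inl R⟩ => Sum.inl (muSymEquiv ⟨_, R⟩)
  | ⟨_, Sum.inr (Sum.inl R)⟩ => Sum.inr (Sum.inl (hypSymEquiv ⟨_, R⟩))
  | ⟨_, Sum.inr (Sum.inr R)⟩ => Sum.inr (Sum.inr (ltSymEquiv ⟨_, R⟩))

theorem primrec_sum_map {α β γ δ : Type} [Primcodable α] [Primcodable β] [Primcodable γ]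
    [Primcodable δ] {f : α → γ} {g : β → δ} (hf : Primrec f) (hg : Primrec g) :
    Primrec (Sum.map f g) :=
  (Primrec.sumCasesOn (f := fun z : α ⊕ β => z) (g := fun _ a => (Sum.inl (f a) : γ ⊕ δ))
    (h := fun _ b => (Sum.inr (g b) : γ ⊕ δ)) Primrec.id
    (Primrec.sumInl.comp (hf.comp Primrec.snd))
    (Primrec.sumInr.comp (hg.comp Primrec.snd))).of_eq fun z => by cases z <;> rfl

theorem primrec_symbolCode : Primrec symbolCode := by
  have h1 : Primrec muSymEquiv := Primrec.of_equiv
  have h2 : Primrec hypSymEquiv := Primrec.of_equiv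
  have h3 : Primrec ltSymEquiv := Primrec.of_equiv
  have h4 : Primrec fun R : Σ n, (hypLang.sum ltLang).Relations n =>
      Equiv.sigmaSumDistrib hypLang.Relations ltLang.Relations R := Primrec.of_equiv
  have h5 : Primrec fun R : Σ n, (compLang hypLang ltLang).Relations n =>
      Equiv.sigmaSumDistrib muLang.Relations (hypLang.sum ltLang).Relations R := Primrec.of_equiv
  exact ((primrec_sum_map h1 ((primrec_sum_map h2 h3).comp h4)).comp h5).of_eq
    fun ⟨_, R⟩ => by rcases R with R | R | R <;> rfl

/-- The decision procedure for `μ`. -/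
def decideMu (p : CompUniv × CompUniv) : Bool := p.2.isLeft && decide (base p.1 = base p.2)

/-- The decision procedure for the relations `D i`. -/
def decideD (i : ℕ) (p : CompUniv × CompUniv) : Bool :=
  (p.1.isLeft && p.2.isLeft) && ((base p.1).isLeft &&
    decide (base p.2 = Sum.inr (i, memBool (finset (base p.1)) i)))

/-- The decision procedure for the relations `E i`. -/
def decideE (i : ℕ) (p : CompUniv × CompUniv) : Bool :=
  (p.1.isLeft && p.2.isLeft) && (((base p.1).isLeft && (base p.2).isLeft) &&
    -- The singleton is written as a list to fit `primrecPred_symmDiff_eq`.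
    decide (symmDiff (finset (base p.1)) (finset (base p.2)) = [i].toFinset))

/-- The decision procedure for `<`, from a decision procedure for the orders on the components. -/
def decideLt (t : Hyp × ℕ × ℕ → Bool) (p : CompUniv × CompUniv) : Bool :=
  !(p.1.isLeft || p.2.isLeft) &&
    (decide (base p.1 = base p.2) && t (base p.1, number p.1, number p.2))

theorem decideMu_iff (u v : CompUniv) : RelMu u v ↔ decideMu (u, v) = true := by
  rcases u with z | ⟨z, a⟩ <;> rcases v with w | ⟨w, b⟩ <;> 
    simp only [decideMu, Bool.and_eq_true, decide_eq_true_eq] <;> simp [RelMu, base]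

theorem decideD_iff (i : ℕ) (u v : CompUniv) : RelD i u v ↔ decideD i (u, v) = true := by
  rcases u with (X | ⟨j, a⟩) | ⟨z, a⟩ <;> rcases v with (Y | ⟨l, b⟩) | ⟨w, b⟩ <;>
    simp only [decideD, Bool.and_eq_true, decide_eq_true_eq] <;>
    simp [RelD, base, finset, memBool]
  rintro rfl
  rfl

theorem decideE_iff (i : ℕ) (u v : CompUniv) : RelE i u v ↔ decideE i (u, v) = true := by
  rcases u with (X | ⟨j, a⟩) | ⟨z, a⟩ <;> rcases v with (Y | ⟨l, b⟩) | ⟨w, b⟩ <;>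
    simp only [decideE, Bool.and_eq_true, decide_eq_true_eq] <;> simp [RelE, base, finset]

theorem decideLt_iff {r : Hyp → ℕ → ℕ → Prop} {t : Hyp × ℕ × ℕ → Bool}
    (h : ∀ z a b, r z a b ↔ t (z, a, b) = true) (u v : CompUniv) :
    RelLt r u v ↔ decideLt t (u, v) = true := by
  rcases u with z | ⟨z, a⟩ <;> rcases v with w | ⟨w, b⟩ <;>
    simp only [decideLt, Bool.and_eq_true, decide_eq_true_eq] <;>
    simp [RelLt, base, number, h]
  rintro -
  exact eq_comm

theorem primrec_decideMu : Primrec decideMu :=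
  Primrec.and.comp (primrec_isLeft.comp Primrec.snd) (Primrec.eq.decide.comp
    (primrec_base.comp Primrec.fst) (primrec_base.comp Primrec.snd))

theorem primrec_isLeft_and {α β : Type} [Primcodable α] [Primcodable β] :
    Primrec fun p : (α ⊕ β) × (α ⊕ β) => p.1.isLeft && p.2.isLeft :=
  Primrec.and.comp (primrec_isLeft.comp Primrec.fst) (primrec_isLeft.comp Primrec.snd)

theorem primrec_decideD : Primrec₂ decideD := by
  have hb : Primrec fun q : ℕ × CompUniv × CompUniv => base q.2.1 :=
    primrec_base.comp (Primrec.fst.comp Primrec.snd)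
  have hv : Primrec fun q : ℕ × CompUniv × CompUniv =>
      (Sum.inr (q.1, memBool (finset (base q.2.1)) q.1) : Hyp) :=
    Primrec.sumInr.comp (Primrec.fst.pair
      (primrec_memBool.comp (primrec_finset.comp hb) Primrec.fst))
  have he : Primrec fun q : ℕ × CompUniv × CompUniv =>
      decide (base q.2.2 = Sum.inr (q.1, memBool (finset (base q.2.1)) q.1)) :=
    Primrec.eq.decide.comp (primrec_base.comp (Primrec.snd.comp Primrec.snd)) hv
  exact Primrec.and.comp (primrec_isLeft_and.comp Primrec.snd)
    (Primrec.and.comp (primrec_isLeft.comp hb) he)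

theorem primrec_decideE : Primrec₂ decideE := by
  have hb : Primrec fun q : ℕ × CompUniv × CompUniv => (base q.2.1, base q.2.2) :=
    (primrec_base.comp (Primrec.fst.comp Primrec.snd)).pair
      (primrec_base.comp (Primrec.snd.comp Primrec.snd))
  have hl : Primrec fun q : ℕ × CompUniv × CompUniv => [q.1] :=
    Primrec.list_cons.comp Primrec.fst (Primrec.const [])
  have he : Primrec fun q : ℕ × CompUniv × CompUniv =>
      decide (symmDiff (finset (base q.2.1)) (finset (base q.2.2)) = [q.1].toFinset) :=
    primrecPred_symmDiff_eq.decide.comp ((primrec_finset.comp (Primrec.fst.comp hb)).pair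
      ((primrec_finset.comp (Primrec.snd.comp hb)).pair hl))
  exact Primrec.and.comp (primrec_isLeft_and.comp Primrec.snd)
    (Primrec.and.comp (primrec_isLeft_and.comp hb) he)

theorem computable_decideLt {t : Hyp × ℕ × ℕ → Bool} (ht : Computable t) :
    Computable (decideLt t) := by
  have h1 : Primrec fun p : CompUniv × CompUniv => !(p.1.isLeft || p.2.isLeft) :=
    Primrec.not.comp (Primrec.or.comp (primrec_isLeft.comp Primrec.fst)
      (primrec_isLeft.comp Primrec.snd))
  have h2 : Primrec fun p : CompUniv × CompUniv => decide (base p.1 = base p.2) :=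
    Primrec.eq.decide.comp (primrec_base.comp Primrec.fst) (primrec_base.comp Primrec.snd)
  have h3 : Computable fun p : CompUniv × CompUniv => t (base p.1, number p.1, number p.2) :=
    ht.comp ((primrec_base.comp Primrec.fst).pair ((primrec_number.comp Primrec.fst).pair
      (primrec_number.comp Primrec.snd))).to_comp
  exact Primrec.and.to_comp.comp h1.to_comp (Primrec.and.to_comp.comp h2.to_comp h3)

/-- The decision procedure for the relations of a composition. -/
def decideRel (t : Hyp × ℕ × ℕ → Bool) (R : Σ n, (compLang hypLang ltLang).Relations n)
    (p : CompUniv × CompUniv) : Bool :=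
  Sum.elim (fun _ => decideMu p)
    (Sum.elim (Sum.elim (fun i => decideD i p) fun i => decideE i p) fun _ => decideLt t p)
    (symbolCode R)

theorem computable_sumElim {α β γ σ : Type} [Primcodable α] [Primcodable β] [Primcodable γ]
    [Primcodable σ] {f : α → γ → σ} {g : β → γ → σ} (hf : Computable₂ f) (hg : Computable₂ g) :
    Computable₂ fun (c : α ⊕ β) (p : γ) => Sum.elim (fun a => f a p) (fun b => g b p) c :=
  (Computable.sumCasesOn Computable.fst (g := fun (q : (α ⊕ β) × γ) a => f a q.2)
    (h := fun (q : (α ⊕ β) × γ) b => g b q.2)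
    (hf.comp Computable.snd (Computable.snd.comp Computable.fst))
    (hg.comp Computable.snd (Computable.snd.comp Computable.fst))).of_eq fun q => by
      rcases q with ⟨_ | _, _⟩ <;> rfl

theorem computable_decideRel {t : Hyp × ℕ × ℕ → Bool} (ht : Computable t) :
    Computable₂ (decideRel t) := by
  have h1 : Computable₂ fun (_ : Unit) p => decideMu p :=
    primrec_decideMu.to_comp.comp Computable.snd
  have h2 : Computable₂ fun (_ : Unit) p => decideLt t p :=
    (computable_decideLt ht).comp Computable.snd
  have h3 := computable_sumElim h1 (computable_sumElim
    (computable_sumElim primrec_decideD.to_comp primrec_decideE.to_comp) h2)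
  have h4 : Computable fun q : (Σ n, (compLang hypLang ltLang).Relations n) × CompUniv × CompUniv =>
      symbolCode q.1 := primrec_symbolCode.to_comp.comp Computable.fst
  exact (Computable₂.comp h3 h4 Computable.snd).of_eq fun _ => rfl

theorem computableStructure_orderComposition {r : Hyp → ℕ → ℕ → Prop} {t : Hyp × ℕ × ℕ → Bool}
    (ht : Computable t) (h : ∀ z a b, r z a b ↔ t (z, a, b) = true) :
    ComputableStructure (orderComposition r) := by
  have : Inhabited CompUniv := ⟨Sum.inl (Sum.inl ∅)⟩
  refine (uniformlyComputable_of_binary (A := fun _ : Unit => orderComposition r)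
    (T := fun _ R p => decideRel t R p) ?_ ?_ ?_).computableStructure ()
  · rintro ⟨_, R⟩
    rcases R with R | R | R <;> cases R <;> rfl
  · exact (computable_decideRel ht).comp (Computable.snd.comp Computable.fst) Computable.snd
  · intro _ R v
    rcases R with R | R | R <;> cases R
    · exact decideMu_iff _ _
    · exact (relMap_D _ _ _).trans (decideD_iff _ _ _)
    · exact (relMap_E _ _ _).trans (decideE_iff _ _ _)
    · exact (relMap_lt _ _).trans (decideLt_iff h _ _)

theorem computableStructure_componentOrder {x : ℕ → ℕ → ℕ} (hx : Computable₂ x) {s : Hyp → Bool}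
    (hs : Computable s) : ComputableStructure (orderComposition (componentOrder x s)) := by
  refine computableStructure_orderComposition (t := fun q => bif s q.1 then
    decide (ltEnum (x (slot q.1)) q.2.1 q.2.2) else decide (q.2.1 < q.2.2)) ?_ ?_
  · exact Computable.cond (hs.comp Computable.fst)
      (computable_decide_ltEnum hx (computable_slot.comp Computable.fst)
        (Computable.fst.comp Computable.snd) (Computable.snd.comp Computable.snd))
      (computable_decide_lt.comp (Computable.fst.comp Computable.snd)
        (Computable.snd.comp Computable.snd))
  · intro z a b
    cases h : s z <;> simp [componentOrder, h]

end IsoSpectra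

/-! ### The main theorem -/

open IsoSpectra
theorem mainTheorem3 :
    (∃ X : ℕ → Set ℕ, UniformlyCE X ∧ Pairwise fun m n => ¬ deg (X m) ≤ deg (X n)) ∧
    ∀ X : ℕ → Set ℕ, UniformlyCE X → (Pairwise fun m n => ¬ deg (X m) ≤ deg (X n)) →
      (∃ x : ℕ → ℕ → ℕ, UniformEnumeration x X) ∧
      ∀ x : ℕ → ℕ → ℕ, UniformEnumeration x X →
        UniformlyComputable copiesA ∧ UniformlyComputable (copiesB x) ∧
        (∀ n, Nonempty (Iso (copiesA n) (copiesB x n))) ∧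
        ComputableStructure (structureM copiesA (copiesB x)) ∧
        ComputableStructure (structureN copiesA (copiesB x)) ∧
        Nonempty (Iso (structureM copiesA (copiesB x)) (structureN copiesA (copiesB x))) ∧
        IsoSpec (structureM copiesA (copiesB x)) (structureN copiesA (copiesB x)) =
          ⋃ n, IsoSpec (copiesA n) (copiesB x n) ∧
        IsoSpec (structureM copiesA (copiesB x)) (structureN copiesA (copiesB x)) =
          ⋃ n, Set.Ici (deg (X n)) ∧
        ¬ FinitelyGenerated
            (IsoSpec (structureM copiesA (copiesB x)) (structureN copiesA (copiesB x))) := by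
  refine ⟨exists_incomparable, fun X hX hinc =>
    ⟨exists_uniformEnumeration hX (infinite_of_incomparable hinc), fun x hx => ?_⟩⟩
  have hspec : IsoSpec (structureM copiesA (copiesB x)) (structureN copiesA (copiesB x)) =
      ⋃ n, Set.Ici (deg (X n)) := by
    rw [isoSpec_structures]
    exact Set.iUnion_congr (isoSpec_copies hx)
  refine ⟨uniformlyComputable_copiesA, uniformlyComputable_copiesB hx.1, nonempty_iso_copies hx,
    ?_, ?_, nonempty_iso_structures hx, isoSpec_structures x, hspec, ?_⟩
  · rw [structureM_eq]
    exact computableStructure_componentOrder hx.1 computable_signM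
  · rw [structureN_eq]
    exact computableStructure_componentOrder hx.1 computable_signN
  · rw [hspec]
    exact not_finitelyGenerated hinc
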